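/- All graphs are finite and simple. A total coloring of a graph $G$ assigns a color to every vertex and every edge of $G$ so that adjacent vertices receive different colors, adjacent edges receive different colors, and every edge receives a color different from those of its two endpoints; the total chromatic number $\chi_T(G)$ is the least number of colors in a total coloring of $G$. Let $\Delta(G)$ denote the maximum degree of $G$ (with $\Delta(G)=0$ if $G$ has no vertices). Theorem 1. Every graph $G$ satisfies $$\chi_T(G)\le \Delta(G)+2\left\lceil\frac{|V(G)|}{\Delta(G)+1}\right\rceil .$$ If $\Delta(G)\ge 1$, this bound is smaller by at least one than Hind's bound $\Delta(G)+2\left\lceil\frac{|V(G)|}{\Delta(G)}\right\rceil+1$, that is, $$\Delta(G)+2\left\lceil\frac{|V(G)|}{\Delta(G)+1}\right\rceil+1\le \Delta(G)+2\left\lceil\frac{|V(G)|}{\Delta(G)}\right\rceil+1 .$$ In particular, if $\Delta(G)\ge \frac12|V(G)|$, then $G$ has a total coloring using at most $\Delta(G)+4$ colors. -/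

import Mathlib

namespace SimpleGraph

/-- A total coloring of `G` with colors in `α`: an assignment of colors to the vertices and the
edges of `G` such that adjacent vertices, adjacent edges (two distinct edges with a common
endpoint), and incident vertex-edge pairs receive different colors. -/
structure IsTotalColoring {V α : Type*} (G : SimpleGraph V) (c : V ⊕ G.edgeSet → α) : Prop where
  vertex_ne : ∀ u v : V, G.Adj u v → c (Sum.inl u) ≠ c (Sum.inl v)
  edge_ne : ∀ e f : G.edgeSet, e ≠ f → (∃ v : V, v ∈ (e : Sym2 V) ∧ v ∈ (f : Sym2 V)) →
    c (Sum.inr e) ≠ c (Sum.inr f)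
  incident_ne : ∀ (v : V) (e : G.edgeSet), v ∈ (e : Sym2 V) → c (Sum.inl v) ≠ c (Sum.inr e)

/-- `G` has a total coloring that uses at most `k` colors. -/
def TotalColorable {V : Type*} (G : SimpleGraph V) (k : ℕ) : Prop :=
  ∃ c : V ⊕ G.edgeSet → Fin k, G.IsTotalColoring c

/-- The total chromatic number: the minimum number of colors in a total coloring of `G`
(`⊤` if finitely many colors do not suffice, which does not happen for finite graphs). -/
noncomputable def totalChromaticNumber {V : Type*} (G : SimpleGraph V) : ℕ∞ :=
  ⨅ k ∈ {k : ℕ | G.TotalColorable k}, (k : ℕ∞)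

end SimpleGraph

/-! Let d be the maximum degree and r = ⌈|V|/(d+1)⌉. The Hajnal–Szemerédi theorem gives a proper
vertex colouring with d+1 colours and at most r vertices per colour (`exists_coloring_card_le`). If
r ≥ 2, the palette of d+2r colours contains a colour β used at no vertex, and the colouring extends
to the edges (`exists_edge_coloring`). If r = 1, that extension would need one colour more; instead
a new vertex is joined to all others, the join is edge-coloured by Vizing's theorem, and each vertex
takes the colour of its edge to the new vertex (`totalColorable_of_card_le_succ`).

The extension is a Vizing-type argument. In a partial edge colouring with as many coloured edges as
possible, let xy be uncoloured and let F be the set of all vertices reachable from y by fan steps at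
x. A colour missing in F is never missing at x, so at most |F| colours are missing somewhere in F.
Each vertex of F misses at least r+1 colours and y misses one more, so some α is missing at r+2 or
more vertices of F. But exchanging α and β along the chain from such a vertex must fail, and only a
vertex coloured α or the centre x can obstruct it. There are at most r vertices coloured α, each an
end of its chain, and x accounts for at most one further chain: at most r+1 fan vertices miss α, a
contradiction.

Hajnal–Szemerédi is proved in the manner of Kierstead and Kostochka. Adding the edges at one vertex
may leave one class too small and one too large by one. Either a vertex can be passed along classes
from the large one to the small one, or an exchange, combined with recolouring the inaccessible part
by induction on the number of colours, repairs the colouring or makes a further class accessible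
(`EquitablyColorable.of_nearly`). -/

namespace SimpleGraph

/-! ### Repetition-free walks of a relation -/

/-- `SimpleWalk R a T b`: there is an `R`-path from `a` to `b` without repetitions whose set of
vertices is `T`. -/
inductive SimpleWalk {α : Type*} (R : α → α → Prop) (a : α) : Set α → α → Prop
  | single : SimpleWalk R a {a} a
  | snoc {T : Set α} {b c : α} : SimpleWalk R a T b → R b c → c ∉ T →
      SimpleWalk R a (insert c T) c

namespace SimpleWalk

variable {α : Type*} {R : α → α → Prop} {a b : α} {T : Set α}

theorem start_mem (h : SimpleWalk R a T b) : a ∈ T := by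
  induction h with
  | single => simp
  | snoc _ _ _ ih => exact Set.mem_insert_of_mem _ ih

theorem exists_prefix (h : SimpleWalk R a T b) {c : α} (hc : c ∈ T) :
    ∃ T', SimpleWalk R a T' c := by
  induction h with
  | single => obtain rfl : c = a := hc; exact ⟨_, single⟩
  | @snoc T b d h hr hd ih =>
    rcases hc with rfl | hc
    · exact ⟨_, snoc h hr hd⟩
    · exact ih hc

theorem of_reflTransGen (h : Relation.ReflTransGen R a b) : ∃ T, SimpleWalk R a T b := by
  induction h with
  | refl => exact ⟨_, single⟩
  | @tail b c _ hr ih =>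
    obtain ⟨T, hT⟩ := ih
    by_cases hc : c ∈ T
    · exact hT.exists_prefix hc
    · exact ⟨_, snoc hT hr hc⟩

theorem reflTransGen (h : SimpleWalk R a T b) : Relation.ReflTransGen R a b := by
  induction h with
  | single => exact .refl
  | snoc _ hr _ ih => exact ih.tail hr

theorem reflTransGen_of_mem (h : SimpleWalk R a T b) {c : α} (hc : c ∈ T) :
    Relation.ReflTransGen R a c := by
  obtain ⟨T', h'⟩ := h.exists_prefix hc
  exact h'.reflTransGen

end SimpleWalk

/-! ### Equitable colouring: shifts along classes and counting lemmas -/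

section EquitableColoring

open Classical Finset Relation

variable {V : Type*} {G : SimpleGraph V} {S : Finset V} {f : V → ℕ}

/-- Some vertex of `S` of colour `c` has no neighbour in `S` of colour `d`. -/
def Movable (G : SimpleGraph V) (S : Finset V) (f : V → ℕ) (c d : ℕ) : Prop :=
  ∃ v ∈ S, f v = c ∧ ∀ w ∈ S, f w = d → ¬ G.Adj v w

/-- `f` is proper on `S` with colours from `C`. -/
structure IsProperOn (G : SimpleGraph V) (S : Finset V) (C : Finset ℕ) (f : V → ℕ) : Prop where
  mem : ∀ v ∈ S, f v ∈ C
  ne : ∀ u ∈ S, ∀ v ∈ S, G.Adj u v → f u ≠ f v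

/-- Inserting a vertex into the first colour class of a path of movable classes. -/
theorem exists_insert_shift {a d : ℕ} {T : Set ℕ}
    (hf : ∀ u ∈ S, ∀ v ∈ S, G.Adj u v → f u ≠ f v)
    (hT : SimpleWalk (fun d e => Movable G S f e d) a T d) :
    ∀ v ∈ S, f v ∉ T → (∀ w ∈ S, f w = d → ¬ G.Adj v w) →
      ∃ g : V → ℕ, g v = d ∧ (∀ u, u ≠ v → f u ∉ T → g u = f u) ∧
        (∀ u, f u ∈ T → g u ∈ T) ∧
        (∀ u ∈ S, ∀ v ∈ S, G.Adj u v → g u ≠ g v) ∧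
        ∀ e ∈ T, #{u ∈ S | g u = e} = #{u ∈ S | f u = e} + if e = a then 1 else 0 := by
  have key : ∀ (g : V → ℕ) (v : V) (d : ℕ), v ∈ S →
      (∀ u ∈ S, ∀ w ∈ S, G.Adj u w → g u ≠ g w) → (∀ w ∈ S, g w = d → ¬ G.Adj v w) →
      ∀ u ∈ S, ∀ w ∈ S, G.Adj u w → Function.update g v d u ≠ Function.update g v d w := by
    intro g v d hv hg hd u hu w hw huw
    by_cases h1 : u = v
    · subst h1
      have : w ≠ u := huw.ne'
      simp only [Function.update_self, Function.update_of_ne this]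
      exact fun h => hd w hw h.symm huw
    · by_cases h2 : w = v
      · subst h2
        simp only [Function.update_self, Function.update_of_ne h1]
        exact fun h => hd u hu h huw.symm
      · simp only [Function.update_of_ne h1, Function.update_of_ne h2]
        exact hg u hu w hw huw
  induction hT with
  | single =>
    intro v hv hvT hvd
    refine ⟨Function.update f v a, by simp, fun u hu _ => by simp [hu], ?_, ?_, ?_⟩
    · intro u hu
      by_cases h : u = v
      · simp [h]
      · simpa [h] using hu
    · exact key f v a hv hf hvd
    · rintro e rfl
      have : ({u ∈ S | Function.update f v e u = e} : Finset V) = insert v {u ∈ S | f u = e} := by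
        ext u
        by_cases h : u = v
        · subst h; simp [hv]
        · simp [h]
      rw [this, card_insert_of_notMem]
      · simp
      · simp only [Set.mem_singleton_iff] at hvT
        simp [hvT]
  | @snoc T e d hT hr hd ih =>
    intro v hv hvT hvd
    obtain ⟨u, hu, hud, huw⟩ := hr
    -- The vertex `u` leaves class `d` to make room for `v` and is inserted into the shorter walk,
    -- ending at `e`.
    obtain ⟨g, hgu, hg1, hg2, hg3, hg4⟩ := ih u hu (hud ▸ hd) huw
    simp only [Set.mem_insert_iff, not_or] at hvT
    have hvu : v ≠ u := fun h => hvT.1 (h ▸ hud)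
    have hgv : g v = f v := hg1 v hvu hvT.2
    have heT : e ∈ T := by cases hT <;> simp
    have hed : e ≠ d := fun h => hd (h ▸ heT)
    have hgd : ∀ w, g w = d → f w = d ∧ w ≠ u := by
      intro w hw
      have hwu : w ≠ u := fun h => hed (by rw [← hw, h, hgu])
      by_cases hwT : f w ∈ T
      · exact absurd (hg2 w hwT) (hw ▸ hd)
      · exact ⟨by rw [← hg1 w hwu hwT, hw], hwu⟩
    refine ⟨Function.update g v d, by simp, ?_, ?_, ?_, ?_⟩
    · intro w hw hwT
      simp only [Set.mem_insert_iff, not_or] at hwT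
      rw [Function.update_of_ne hw]
      exact hg1 w (fun h => hwT.1 (h ▸ hud)) hwT.2
    · intro w hw
      by_cases h : w = v
      · simp [h]
      · rw [Function.update_of_ne h]
        by_cases hwu : w = u
        · right; rw [hwu, hgu]; exact heT
        · rcases hw with hw | hw
          · left; rw [hg1 w hwu (hw ▸ hd), hw]
          · right; exact hg2 w hw
    · exact key g v d hv hg3 fun w hw hwd => hvd w hw (hgd w hwd).1
    · rintro x (rfl | hx)
      · have hxa : x ≠ a := fun h => hd (h ▸ hT.start_mem)
        have : ({w ∈ S | Function.update g v x w = x} : Finset V) =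
            insert v (({w ∈ S | f w = x} : Finset V).erase u) := by
          ext w
          by_cases h : w = v
          · subst h; simp [hv]
          · simp only [mem_filter, Function.update_of_ne h, mem_insert, h, false_or, mem_erase]
            constructor
            · rintro ⟨h1, h2⟩; exact ⟨(hgd w h2).2, h1, (hgd w h2).1⟩
            · rintro ⟨h1, h2, h3⟩; exact ⟨h2, by rw [hg1 w h1 (h3 ▸ hd), h3]⟩
        rw [this, card_insert_of_notMem (by simp [hvT.1]), card_erase_of_mem (by simp [hu, hud]),
          if_neg hxa]
        have : 0 < #{w ∈ S | f w = x} := card_pos.2 ⟨u, by simp [hu, hud]⟩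
        omega
      · rw [← hg4 x hx]
        congr 1
        ext w
        have hxd : x ≠ d := fun h => hd (h ▸ hx)
        by_cases h : w = v
        · subst h
          have : f w ≠ x := fun h => hvT.2 (h ▸ hx)
          simp [hgv, this, hxd.symm]
        · simp [h]

/-- Among the elements reachable from `a` there is a set `T` of elements whose deletion leaves
all others reachable, and a single further element `U` through which `T` is reached. -/
theorem exists_terminal_set {α : Type*} {R : α → α → Prop} {a : α} {A : Finset α} (ha : a ∈ A)
    (hA : 1 < #A) (hreach : ∀ c ∈ A, ReflTransGen R a c) :
    ∃ U ∈ A, ∃ T ⊆ A, T.Nonempty ∧ U ∉ T ∧ a ∉ T ∧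
      (∀ W ∈ T, ∀ c ∈ A, c ≠ W → ReflTransGen (fun e d => R e d ∧ e ≠ W ∧ d ≠ W) a c) ∧
      ∀ W ∈ T, ∀ c ∈ A, c ∉ T → c ≠ U → ¬ R c W := by
  set av : α → α → Prop := fun X c => ReflTransGen (fun e d => R e d ∧ e ≠ X ∧ d ≠ X) a c with hav
  set Ts : α → Finset α := fun X => A.filter fun c => c ≠ X ∧ ¬ av X c with hTs
  have hself : ∀ X, av X X → a = X := by
    intro X h
    rcases ReflTransGen.cases_tail h with h | ⟨_, _, h⟩
    · exact h.symm
    · exact absurd rfl h.2.2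
  have hne : (A.filter fun X => (Ts X).Nonempty).Nonempty := by
    refine ⟨a, mem_filter.2 ⟨ha, ?_⟩⟩
    obtain ⟨c, hc, hca⟩ := exists_mem_ne hA a
    refine ⟨c, mem_filter.2 ⟨hc, hca, fun h => ?_⟩⟩
    rcases ReflTransGen.cases_head h with h | ⟨_, h, _⟩
    · exact hca h.symm
    · exact h.2.1 rfl
  -- `U` is an element whose deletion cuts off something, but as little as possible; `T` is what it
  -- cuts off. The start `a` is a candidate, since deleting it cuts off everything else.
  obtain ⟨U, hU, hmin⟩ := exists_min_image _ (fun X => #(Ts X)) hne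
  obtain ⟨hUA, hUT⟩ := mem_filter.1 hU
  refine ⟨U, hUA, Ts U, filter_subset _ _, hUT, by simp [hTs], ?_, ?_, ?_⟩
  · intro h
    exact (mem_filter.1 h).2.2 ReflTransGen.refl
  · intro W hW c hc hcW
    obtain ⟨hWA, hWU, hWav⟩ := mem_filter.1 hW
    have hmono : ∀ c, av U c → av W c := by
      intro c h
      induction h with
      | refl => exact .refl
      | @tail e d he hr ih =>
        exact ih.tail ⟨hr.1, fun h => hWav (h ▸ he), fun h => hWav (h ▸ he.tail hr)⟩
    -- Follow a path to `U` up to its first visit to `U`: before that it avoids `U`, hence also `W`.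
    have hUW : av W U := by
      have : ∀ c, ReflTransGen R a c → av U c ∨ av W U := by
        intro c h
        induction h with
        | refl => exact .inl .refl
        | @tail e d _ hr ih =>
          rcases ih with ih | ih
          · by_cases hd : d = U
            · subst hd
              exact .inr ((hmono e ih).tail ⟨hr, fun h => hWav (h ▸ ih), hWU.symm⟩)
            · by_cases he : e = U
              · subst he
                exact .inr (hmono _ ih)
              · exact .inl (ih.tail ⟨hr, he, hd⟩)
          · exact .inr ih
      rcases this U (hreach U hUA) with h | h
      · exact hmono _ h
      · exact h
    by_contra hcon
    -- What `W` cuts off lies in what `U` cuts off, and `W` itself belongs only to the latter.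
    have hlt : #(Ts W) < #(Ts U) := by
      refine card_lt_card ((ssubset_iff_of_subset ?_).2 ⟨W, hW, by simp [hTs]⟩)
      intro d hd
      obtain ⟨hdA, hdW, hdav⟩ := mem_filter.1 hd
      refine mem_filter.2 ⟨hdA, ?_, fun h => hdav (hmono d h)⟩
      rintro rfl
      exact hdav hUW
    exact absurd (hmin W (mem_filter.2 ⟨hWA, c, mem_filter.2 ⟨hc, hcW, hcon⟩⟩)) (not_le.2 hlt)
  · intro W hW c hc hcT hcU hr
    obtain ⟨hWA, hWU, hWav⟩ := mem_filter.1 hW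
    have : av U c := by
      by_contra h
      exact hcT (mem_filter.2 ⟨hc, hcU, h⟩)
    exact hWav (this.tail ⟨hr, hcU, hWU⟩)

theorem card_neighbors_eq_sum (A : Finset ℕ) (y : V) :
    #{w ∈ S | G.Adj y w} = ∑ c ∈ A, #{w ∈ S | f w = c ∧ G.Adj y w} +
      #{w ∈ S | f w ∉ A ∧ G.Adj y w} := by
  rw [← card_filter_add_card_filter_not (s := {w ∈ S | G.Adj y w}) (fun w => f w ∈ A)]
  congr 1
  · rw [card_eq_sum_card_fiberwise (f := f) (t := A)]
    · refine sum_congr rfl fun c hc => ?_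
      congr 1; ext w; simp only [mem_filter]
      constructor
      · rintro ⟨⟨⟨h1, h2⟩, h3⟩, h4⟩; exact ⟨h1, h4, h2⟩
      · rintro ⟨h1, h2, h3⟩; exact ⟨⟨⟨h1, h3⟩, h2 ▸ hc⟩, h2⟩
    · intro w hw
      simp at hw
      exact hw.2
  · congr 1; ext w; simp only [mem_filter]; tauto

theorem sum_card_neighbors_comm (P Q : Finset V) :
    ∑ z ∈ P, #{y ∈ Q | G.Adj z y} = ∑ y ∈ Q, #{z ∈ P | G.Adj y z} := by
  have := sum_card_bipartiteAbove_eq_sum_card_bipartiteBelow (s := P) (t := Q) G.Adj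
  simp only [bipartiteAbove, bipartiteBelow] at this
  simpa only [G.adj_comm] using this

/-- Double counting the edges between a class `P` and `Q`, where vertices of `P` that are the only
neighbour in `P` of some vertex of `Q` have few neighbours in `Q`. -/
theorem lt_of_solo_degree_le {P Q : Finset V} {q t s : ℕ} (hP : #P = s) (hQ : #Q = q * s + 1)
    (h1 : ∀ y ∈ Q, ∃ z ∈ P, G.Adj y z)
    (h2 : ∀ z ∈ P, ∀ y ∈ Q, ({w ∈ P | G.Adj y w} : Finset V) = {z} → #{y ∈ Q | G.Adj z y} ≤ q)
    (h3 : ∀ z ∈ P, #{y ∈ Q | G.Adj z y} ≤ q + t) : q < t := by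
  set solo : V → Prop := fun z => ∃ y ∈ Q, ({w ∈ P | G.Adj y w} : Finset V) = {z} with hsolo
  -- A vertex of `Q` with a single neighbour in `P` is counted again through that solo neighbour. So
  -- a solo vertex contributes at most 2q to the sum and any other at most q+t; if t ≤ q the total
  -- is at most 2qs, short of 2(qs+1).
  have hcount : ∀ y ∈ Q, 2 ≤ #{z ∈ P | G.Adj y z} + #{z ∈ {z ∈ P | solo z} | G.Adj y z} := by
    intro y hy
    obtain ⟨z, hz, hyz⟩ := h1 y hy
    have hpos : 0 < #{z ∈ P | G.Adj y z} := card_pos.2 ⟨z, by simp [hz, hyz]⟩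
    by_cases h : #{z ∈ P | G.Adj y z} = 1
    · obtain ⟨x, hx⟩ := card_eq_one.1 h
      have hx' : x ∈ ({z ∈ P | G.Adj y z} : Finset V) := by simp [hx]
      have : 0 < #{z ∈ {z ∈ P | solo z} | G.Adj y z} := by
        refine card_pos.2 ⟨x, ?_⟩
        simp only [mem_filter] at hx' ⊢
        exact ⟨⟨hx'.1, y, hy, hx⟩, hx'.2⟩
      omega
    · omega
  have hsum := sum_le_sum hcount
  rw [sum_add_distrib, ← sum_card_neighbors_comm P Q, ← sum_card_neighbors_comm _ Q, sum_const,
    smul_eq_mul, hQ, ← sum_filter_add_sum_filter_not P solo] at hsum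
  have b1 : ∑ z ∈ {z ∈ P | solo z}, #{y ∈ Q | G.Adj z y} ≤ #{z ∈ P | solo z} * q := by
    refine sum_le_card_nsmul _ _ _ fun z hz => ?_
    obtain ⟨hz, y, hy, h⟩ := mem_filter.1 hz
    exact h2 z hz y hy h
  have b2 : ∑ z ∈ {z ∈ P | ¬ solo z}, #{y ∈ Q | G.Adj z y} ≤ #{z ∈ P | ¬ solo z} * (q + t) :=
    sum_le_card_nsmul _ _ _ fun z hz => h3 z (mem_filter.1 hz).1
  have hs := card_filter_add_card_filter_not (s := P) solo
  rw [hP] at hs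
  by_contra hcon
  push Not at hcon
  rw [← hs] at hsum
  nlinarith [Nat.mul_le_mul_left (#{z ∈ P | ¬ solo z}) hcon]

/-- A largest independent subset dominates `Q`, so its closed neighbourhoods cover `Q`. -/
theorem exists_independent_sum_ge (Q : Finset V) :
    ∃ I ⊆ Q, (∀ u ∈ I, ∀ v ∈ I, ¬ G.Adj u v) ∧ #Q ≤ ∑ y ∈ I, (#{w ∈ Q | G.Adj y w} + 1) := by
  obtain ⟨I, hI, hmax⟩ := exists_max_image
    (Q.powerset.filter fun I => ∀ u ∈ I, ∀ v ∈ I, ¬ G.Adj u v) card ⟨∅, by simp⟩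
  simp only [mem_filter, mem_powerset] at hI hmax
  refine ⟨I, hI.1, hI.2, ?_⟩
  have hsub : Q ⊆ I.biUnion fun y => insert y ({w ∈ Q | G.Adj y w} : Finset V) := by
    intro w hw
    rw [mem_biUnion]
    by_cases hwI : w ∈ I
    · exact ⟨w, hwI, by simp⟩
    by_contra hcon
    push Not at hcon
    have hna : ∀ y ∈ I, ¬ G.Adj y w := by
      intro y hy h
      exact hcon y hy (by simp [hw, h])
    have := hmax (insert w I) ⟨insert_subset hw hI.1, by
      intro u hu v hv
      rcases mem_insert.1 hu with rfl | hu' <;> rcases mem_insert.1 hv with rfl | hv'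
      · simp
      · exact fun h => hna v hv' h.symm
      · exact hna u hu'
      · exact hI.2 u hu' v hv'⟩
    rw [card_insert_of_notMem hwI] at this
    omega
  calc #Q ≤ _ := card_le_card hsub
    _ ≤ _ := card_biUnion_le
    _ ≤ _ := sum_le_sum fun y _ => card_insert_le _ _

/-- If the vertices of an independent set have many unique neighbours in the classes of `T`, then
two of them share a unique neighbour. -/
theorem exists_shared_solo {T : Finset ℕ} {Q : Finset V} {q s : ℕ} (hq : q ≤ #T)
    (hT : ∀ c ∈ T, #{v ∈ S | f v = c} = s) (hQ : #Q = q * s + 1)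
    (hdeg : ∀ y ∈ Q, #{w ∈ Q | G.Adj y w} + 1 ≤ q)
    (hsolo : ∀ y ∈ Q, #T + 1 + #{w ∈ Q | G.Adj y w} ≤
      #{c ∈ T | #{w ∈ S | f w = c ∧ G.Adj y w} = 1} + q) :
    ∃ z ∈ S, f z ∈ T ∧ ∃ y₁ ∈ Q, ∃ y₂ ∈ Q, y₁ ≠ y₂ ∧ ¬ G.Adj y₁ y₂ ∧
      ({w ∈ S | f w = f z ∧ G.Adj y₁ w} : Finset V) = {z} ∧
      ({w ∈ S | f w = f z ∧ G.Adj y₂ w} : Finset V) = {z} := by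
  obtain ⟨I, hIQ, hI, hsum⟩ := exists_independent_sum_ge (G := G) Q
  have hIs : s + 1 ≤ #I := by
    have h1 : ∑ y ∈ I, (#{w ∈ Q | G.Adj y w} + 1) ≤ #I * q :=
      sum_le_card_nsmul _ _ _ fun y hy => hdeg y (hIQ hy)
    by_contra hcon
    have : #I * q ≤ s * q := Nat.mul_le_mul_right _ (by omega)
    nlinarith
  set P : Finset V := {z ∈ S | f z ∈ T} with hP
  have hPcard : #P = #T * s := by
    rw [card_eq_sum_card_fiberwise (f := f) (t := T) (s := P)
      (fun w hw => (mem_filter.1 hw).2),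
      ← smul_eq_mul, ← sum_const]
    refine sum_congr rfl fun c hc => ?_
    rw [← hT c hc]
    congr 1; ext w; simp only [hP, mem_filter]
    constructor
    · rintro ⟨⟨h1, _⟩, h2⟩; exact ⟨h1, h2⟩
    · rintro ⟨h1, h2⟩; exact ⟨⟨h1, h2 ▸ hc⟩, h2⟩
  set r : V → V → Prop := fun y z => ({w ∈ S | f w = f z ∧ G.Adj y w} : Finset V) = {z} with hr
  have hσ : ∀ y ∈ I, #T + 1 + #{w ∈ Q | G.Adj y w} ≤ #{z ∈ P | r y z} + q := by
    intro y hy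
    refine (hsolo y (hIQ hy)).trans (Nat.add_le_add_right ?_ q)
    have hch : ∀ c ∈ ({c ∈ T | #{w ∈ S | f w = c ∧ G.Adj y w} = 1} : Finset ℕ),
        ∃ z, ({w ∈ S | f w = c ∧ G.Adj y w} : Finset V) = {z} := fun c hc =>
      card_eq_one.1 (mem_filter.1 hc).2
    have : Nonempty V := ⟨y⟩
    choose! g hg using hch
    have hg' : ∀ c ∈ ({c ∈ T | #{w ∈ S | f w = c ∧ G.Adj y w} = 1} : Finset ℕ),
        g c ∈ S ∧ f (g c) = c := by
      intro c hc
      have : g c ∈ ({w ∈ S | f w = c ∧ G.Adj y w} : Finset V) := by rw [hg c hc]; simp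
      simp only [mem_filter] at this
      exact ⟨this.1, this.2.1⟩
    refine card_le_card_of_injOn g ?_ ?_
    · intro c hc
      have h := hg' c hc
      simp only [hP, hr, coe_filter, Set.mem_ofPred_eq, mem_filter]
      refine ⟨⟨h.1, by rw [h.2]; exact (mem_filter.1 hc).1⟩, ?_⟩
      rw [h.2]
      exact hg c hc
    · intro c hc d hd h
      rw [← (hg' c hc).2, ← (hg' d hd).2, h]
  -- Summing `hσ` over `I`, with #I ≥ s+1 and the closed neighbourhoods totalling at least qs+1,
  -- gives at least (s+1)(#T−q) + qs+1, which exceeds s·#T = #P because q ≤ #T. By pigeonhole some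
  -- `z` is then solo for two vertices of `I`.
  have hlt : #P * 1 < ∑ y ∈ I, #{z ∈ P | r y z} := by
    have h1 := sum_le_sum hσ
    simp only [sum_add_distrib, sum_const, smul_eq_mul, mul_one] at h1 hsum
    rw [hPcard]
    obtain ⟨e, he⟩ := Nat.exists_eq_add_of_le hq
    rw [he] at h1 ⊢
    nlinarith [Nat.mul_le_mul_left e hIs]
  have hcomm := sum_card_bipartiteAbove_eq_sum_card_bipartiteBelow (s := I) (t := P) r
  simp only [bipartiteAbove, bipartiteBelow] at hcomm
  rw [hcomm] at hlt
  have : ∃ z ∈ P, 1 < #{y ∈ I | r y z} := by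
    by_contra hcon
    push Not at hcon
    exact absurd (sum_le_card_nsmul _ _ _ hcon) (not_le.2 hlt)
  obtain ⟨z, hz, hcard⟩ := this
  obtain ⟨y₁, h₁, y₂, h₂, hne⟩ := one_lt_card.1 hcard
  simp only [mem_filter] at h₁ h₂
  exact ⟨z, (mem_filter.1 hz).1, (mem_filter.1 hz).2, y₁, hIQ h₁.1, y₂, hIQ h₂.1, hne,
    hI _ h₁.1 _ h₂.1, h₁.2, h₂.2⟩

/-! ### From nearly equitable to equitable colourings -/

/-- `S` has a proper colouring with colours from `C` all of whose classes have size `s`. -/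
def EquitablyColorable (G : SimpleGraph V) (S : Finset V) (C : Finset ℕ) (s : ℕ) : Prop :=
  ∃ f : V → ℕ, IsProperOn G S C f ∧ ∀ c ∈ C, #{v ∈ S | f v = c} = s

theorem SimpleWalk.mono {α : Type*} {R R' : α → α → Prop} {a b : α} {T : Set α}
    (h : SimpleWalk R a T b) (hR : ∀ x y, R x y → R' x y) : SimpleWalk R' a T b := by
  induction h with
  | single => exact .single
  | snoc _ hr hc ih => exact ih.snoc (hR _ _ hr) hc

theorem SimpleWalk.end_mem {α : Type*} {R : α → α → Prop} {a b : α} {T : Set α}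
    (h : SimpleWalk R a T b) : b ∈ T := by
  cases h <;> simp

/-- Off the walk, a shift changes a class only by removing the inserted vertex. -/
theorem filter_shift_eq_erase {g : V → ℕ} {v : V} {T : Set ℕ} {c : ℕ} (hv : g v ∈ T)
    (h1 : ∀ u, u ≠ v → f u ∉ T → g u = f u) (h2 : ∀ u, f u ∈ T → g u ∈ T) (hc : c ∉ T) :
    ({u ∈ S | g u = c} : Finset V) = ({u ∈ S | f u = c} : Finset V).erase v := by
  ext u
  simp only [mem_filter, mem_erase]
  constructor
  · rintro ⟨hu, hg⟩
    have h3 : u ≠ v := by rintro rfl; exact hc (hg ▸ hv)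
    have h4 : f u ∉ T := fun h => hc (hg ▸ h2 u h)
    exact ⟨h3, hu, by rw [← h1 u h3 h4, hg]⟩
  · rintro ⟨h3, hu, rfl⟩
    exact ⟨hu, h1 u h3 hc⟩

/-- Neighbours forced in classes of `A` use up degree; this is how degrees into the inaccessible
part are bounded. -/
theorem card_add_card_neighbors_le {A D : Finset ℕ} {v : V} (hD : D ⊆ A)
    (h : ∀ c ∈ D, ∃ w ∈ S, f w = c ∧ G.Adj v w) :
    #D + #{w ∈ {w ∈ S | f w ∉ A} | G.Adj v w} ≤ #{w ∈ S | G.Adj v w} := by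
  rw [filter_filter, card_neighbors_eq_sum (S := S) (f := f) A v]
  refine Nat.add_le_add_right ?_ _
  calc #D = ∑ c ∈ D, 1 := by simp
    _ ≤ ∑ c ∈ D, #{w ∈ S | f w = c ∧ G.Adj v w} := sum_le_sum fun c hc => by
        obtain ⟨w, hw⟩ := h c hc
        exact card_pos.2 ⟨w, by simpa using hw⟩
    _ ≤ _ := sum_le_sum_of_subset hD

theorem exists_color_no_neighbor {Q : Finset V} {C : Finset ℕ} {v : V} (h : V → ℕ)
    (hlt : #{w ∈ Q | G.Adj v w} < #C) : ∃ b ∈ C, ∀ w ∈ Q, h w = b → ¬ G.Adj v w := by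
  by_contra hcon
  push Not at hcon
  have : C ⊆ ({w ∈ Q | G.Adj v w} : Finset V).image h := by
    intro b hb
    obtain ⟨w, hw, hwb, hadj⟩ := hcon b hb
    exact mem_image.2 ⟨w, by simp [hw, hadj], hwb⟩
  exact absurd ((card_le_card this).trans card_image_le) (not_le.2 hlt)

/-- A colouring with one class too small and one class too large can be made equitable, given
equitable colourings with fewer colours. -/
theorem EquitablyColorable.of_nearly {k : ℕ}
    (IH : ∀ q < k, ∀ (S : Finset V) (s : ℕ) (C : Finset ℕ), #C = q → #S = q * s →
      (∀ v ∈ S, #{w ∈ S | G.Adj v w} < q) → EquitablyColorable G S C s)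
    {S : Finset V} {C : Finset ℕ} {s : ℕ} (hC : #C = k)
    (hdeg : ∀ v ∈ S, #{w ∈ S | G.Adj v w} < k) (n : ℕ) :
    ∀ (f : V → ℕ) (a p : ℕ), IsProperOn G S C f → a ∈ C → p ∈ C → a ≠ p →
      #{v ∈ S | f v = a} + 1 = s → #{v ∈ S | f v = p} = s + 1 →
      (∀ c ∈ C, c ≠ a → c ≠ p → #{v ∈ S | f v = c} = s) →
      #{c ∈ C | ¬ ReflTransGen (fun e d => d ∈ C ∧ Movable G S f d e) a c} = n →
      EquitablyColorable G S C s := by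
  -- Here `n` counts the classes not accessible from the small class `a`. Each round either finishes
  -- or makes this number smaller.
  induction n using Nat.strong_induction_on with | _ n ihn
  intro f a p hf ha hp hap hsa hsp hs hn
  set R : ℕ → ℕ → Prop := fun e d => d ∈ C ∧ Movable G S f d e with hR
  set A : Finset ℕ := {c ∈ C | ReflTransGen R a c} with hA
  set B : Finset ℕ := {c ∈ C | ¬ ReflTransGen R a c} with hB
  have haA : a ∈ A := mem_filter.2 ⟨ha, .refl⟩
  have hRA : ∀ c, ReflTransGen R a c → c ∈ A := by
    intro c h
    refine mem_filter.2 ⟨?_, h⟩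
    rcases ReflTransGen.cases_tail h with h | ⟨_, _, h⟩
    · exact h ▸ ha
    · exact h.1
  have hAB : #A + n = k := by
    rw [← hn, ← hC]; exact card_filter_add_card_filter_not _
  have hAC : A ⊆ C := filter_subset _ _
  have hBC : B ⊆ C := filter_subset _ _
  have hdisj : ∀ c ∈ A, c ∉ B := fun c hc hc' => (mem_filter.1 hc').2 (mem_filter.1 hc).2
  have hor : ∀ c ∈ C, c ∉ A → c ∈ B := fun c hc h =>
    mem_filter.2 ⟨hc, fun h' => h (mem_filter.2 ⟨hc, h'⟩)⟩
  by_cases hpA : p ∈ A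
  · obtain ⟨T, hT⟩ := SimpleWalk.of_reflTransGen (mem_filter.1 hpA).2
    cases hT with
    | single => exact absurd rfl hap
    | @snoc T d _ hT hr hpT =>
      obtain ⟨-, v, hv, hvp, hvd⟩ := hr
      have hTA : ∀ c ∈ T, c ∈ A := fun c hc => hRA c (hT.reflTransGen_of_mem hc)
      obtain ⟨g, hgv, hg1, hg2, hg3, hg4⟩ :=
        exists_insert_shift hf.ne (hT.mono fun _ _ h => h.2) v hv (hvp ▸ hpT) hvd
      refine ⟨g, ⟨fun u hu => ?_, hg3⟩, fun c hc => ?_⟩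
      · by_cases huv : u = v
        · rw [huv, hgv]; exact hAC (hTA _ hT.end_mem)
        · by_cases huT : f u ∈ T
          · exact hAC (hTA _ (hg2 u huT))
          · rw [hg1 u huv huT]; exact hf.mem u hu
      · by_cases hcT : c ∈ T
        · rw [hg4 c hcT]
          split_ifs with h
          · rw [h, hsa]
          · exact hs c hc h fun h => hpT (h ▸ hcT)
        · rw [filter_shift_eq_erase (hgv ▸ hT.end_mem) hg1 hg2 hcT]
          by_cases hcp : c = p
          · rw [hcp, card_erase_of_mem (by simp [hv, hvp]), hsp]; rfl
          · rw [erase_eq_of_notMem (by simp [hvp, Ne.symm hcp])]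
            exact hs c hc (fun h => hcT (h ▸ hT.start_mem)) hcp
  have hclsA : ∀ c ∈ A, c ≠ a → #{v ∈ S | f v = c} = s := fun c hc hca =>
    hs c (hAC hc) hca fun h => hpA (h ▸ hc)
  set Q : Finset V := {w ∈ S | f w ∉ A} with hQ
  have hQS : Q ⊆ S := filter_subset _ _
  have hQB : ∀ w ∈ Q, f w ∈ B := fun w hw =>
    hor _ (hf.mem w (hQS hw)) (mem_filter.1 hw).2
  have hQcard : #Q = n * s + 1 := by
    rw [card_eq_sum_card_fiberwise (f := f) (t := B) (s := Q) (fun w hw => hQB w hw)]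
    have : ∀ c ∈ B, #{w ∈ Q | f w = c} = s + if c = p then 1 else 0 := by
      intro c hc
      have h1 : ({w ∈ Q | f w = c} : Finset V) = {w ∈ S | f w = c} := by
        ext w
        simp only [hQ, mem_filter]
        constructor
        · rintro ⟨⟨h1, _⟩, h2⟩; exact ⟨h1, h2⟩
        · rintro ⟨h1, h2⟩; exact ⟨⟨h1, fun h => hdisj c (h2 ▸ h) hc⟩, h2⟩
      rw [h1]
      split_ifs with h
      · rw [h, hsp]
      · exact hs c (hBC hc) (fun h => hdisj a haA (h ▸ hc)) h
    rw [sum_congr rfl this, sum_add_distrib, sum_const, hn, sum_ite_eq' B p,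
      if_pos (hor p hp hpA), smul_eq_mul]
  have hQadj : ∀ y ∈ Q, ∀ c ∈ A, ∃ w ∈ S, f w = c ∧ G.Adj y w := by
    intro y hy c hc
    by_contra hcon
    push Not at hcon
    refine hdisj (f y) (hRA _ ((mem_filter.1 hc).2.tail ⟨hBC (hQB y hy), y, hQS hy, rfl, ?_⟩))
      (hQB y hy)
    exact hcon
  have hQdeg : ∀ y ∈ Q, #{w ∈ Q | G.Adj y w} + 1 ≤ n := by
    intro y hy
    have h1 := card_add_card_neighbors_le (S := S) (f := f) (G := G) subset_rfl (hQadj y hy)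
    have h2 := hdeg y (hQS hy)
    rw [← hQ] at h1
    omega
  -- The class `a` is accessible, so n < k and the induction on the number of colours applies. The
  -- degree bound holds because each vertex of `Q` spends a neighbour on every accessible class.
  have hIH : ∀ y ∈ Q, EquitablyColorable G (Q.erase y) B s := by
    intro y hy
    have hA0 : 0 < #A := card_pos.2 ⟨a, haA⟩
    refine IH n (by omega) _ _ _ hn (by rw [card_erase_of_mem hy, hQcard]; rfl) fun v hv => ?_
    have h1 := hQdeg v (mem_of_mem_erase hv)
    have h2 : #{w ∈ Q.erase y | G.Adj v w} ≤ #{w ∈ Q | G.Adj v w} :=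
      card_le_card (filter_subset_filter _ (erase_subset _ _))
    omega
  rcases Nat.lt_or_ge 1 #A with hA1 | hA1
  swap
  -- If only `a` is accessible, its s−1 vertices send at most n edges each into `Q`, too few for the
  -- ns+1 vertices of `Q`, each of which has a neighbour in class `a`.
  · exfalso
    have h1 : ∀ y ∈ Q, 1 ≤ #{z ∈ {v ∈ S | f v = a} | G.Adj y z} := by
      intro y hy
      obtain ⟨w, hw, hwa, hyw⟩ := hQadj y hy a haA
      exact card_pos.2 ⟨w, by simp [hw, hwa, hyw]⟩
    have h2 := card_nsmul_le_sum _ _ _ h1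
    rw [← sum_card_neighbors_comm] at h2
    have h3 : ∑ z ∈ {v ∈ S | f v = a}, #{y ∈ Q | G.Adj z y} ≤ #{v ∈ S | f v = a} * n := by
      refine sum_le_card_nsmul _ _ _ fun z hz => ?_
      have h4 := hdeg z (mem_filter.1 hz).1
      have h5 : #{y ∈ Q | G.Adj z y} ≤ #{y ∈ S | G.Adj z y} :=
        card_le_card (filter_subset_filter _ hQS)
      omega
    rw [hQcard, smul_eq_mul] at h2
    rw [← hsa] at h2
    nlinarith
  obtain ⟨U, hU, T, hTA, hTne, hUT, haT, hterm, hnoR⟩ :=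
    exists_terminal_set haA hA1 fun c hc => (mem_filter.1 hc).2
  have hTcls : ∀ c ∈ T, #{v ∈ S | f v = c} = s := fun c hc =>
    hclsA c (hTA hc) fun h => haT (h ▸ hc)
  have havA : ∀ W c, ReflTransGen (fun e d => R e d ∧ e ≠ W ∧ d ≠ W) a c → c ∈ A := fun W c h =>
    hRA c (ReflTransGen.mono (fun _ _ h => h.1) _ _ h)
  have havne : ∀ W c, a ≠ W → ReflTransGen (fun e d => R e d ∧ e ≠ W ∧ d ≠ W) a c → c ≠ W := by
    intro W c haW h
    rcases ReflTransGen.cases_tail h with h | ⟨_, _, h⟩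
    · exact h ▸ haW
    · exact h.2.2
  -- Such a `z` cannot move to an accessible class outside `T` other than `U`, so at least #A − #T −
  -- 1 of its neighbours lie in accessible classes.
  have hzdeg : ∀ z ∈ S, f z ∈ T → #{y ∈ Q | G.Adj z y} ≤ n + #T := by
    intro z hz hzT
    have hsub : (A \ T).erase U ⊆ A := (erase_subset _ _).trans sdiff_subset
    have h1 := card_add_card_neighbors_le (S := S) (f := f) (G := G) (v := z) hsub (by
      intro c hc
      simp only [mem_erase, mem_sdiff] at hc
      by_contra hcon
      push Not at hcon
      exact hnoR _ hzT c hc.2.1 hc.2.2 hc.1 ⟨hAC (hTA hzT), z, hz, rfl, hcon⟩)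
    rw [card_erase_of_mem (by simp [hU, hUT]), card_sdiff_of_subset hTA, ← hQ] at h1
    have h2 := hdeg z hz
    omega
  have hzdeg' : ∀ z ∈ S, f z ∈ T → (∀ X ∈ A, X ≠ f z → ∃ w ∈ S, f w = X ∧ G.Adj z w) →
      #{y ∈ Q | G.Adj z y} ≤ n := by
    intro z hz hzT h
    have h1 := card_add_card_neighbors_le (S := S) (f := f) (G := G) (v := z)
      (erase_subset (f z) A) fun c hc => h c (mem_of_mem_erase hc) (ne_of_mem_erase hc)
    rw [card_erase_of_mem (hTA hzT), ← hQ] at h1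
    have h2 := hdeg z hz
    omega
  -- If a solo neighbour `z` of `y` can move to another accessible class `X`, then `z` is shifted
  -- towards `a` along a walk avoiding its own class, which exists because that class is in `T`.
  -- Then `y` takes the place of `z`, and the rest of `Q` is recoloured equitably with `B`.
  by_cases hcase : ∃ z ∈ S, f z ∈ T ∧ ∃ y ∈ Q,
      ({w ∈ S | f w = f z ∧ G.Adj y w} : Finset V) = {z} ∧
      ∃ X ∈ A, X ≠ f z ∧ ∀ w ∈ S, f w = X → ¬ G.Adj z w
  · obtain ⟨z, hz, hzT, y, hy, hsolo, X, hX, hXz, hzX⟩ := hcase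
    have haW : a ≠ f z := fun h => haT (h ▸ hzT)
    obtain ⟨T₁, hT₁⟩ := SimpleWalk.of_reflTransGen (hterm _ hzT X hX hXz)
    have hWT : f z ∉ T₁ := fun h => havne _ _ haW (hT₁.reflTransGen_of_mem h) rfl
    have hT₁A : ∀ c ∈ T₁, c ∈ A := fun c hc => havA _ c (hT₁.reflTransGen_of_mem hc)
    obtain ⟨g, hgz, hg1, hg2, hg3, hg4⟩ :=
      exists_insert_shift hf.ne (hT₁.mono fun _ _ h => h.1.2) z hz hWT hzX
    obtain ⟨h, hh, hhs⟩ := hIH y hy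
    have hgT : g z ∈ T₁ := hgz ▸ hT₁.end_mem
    have hgW := filter_shift_eq_erase (S := S) hgT hg1 hg2 hWT
    have hgA : ∀ v, f v ∈ A → g v ∈ A := by
      intro v hv
      by_cases h1 : v = z
      · rw [h1]; exact hT₁A _ hgT
      · by_cases h2 : f v ∈ T₁
        · exact hT₁A _ (hg2 v h2)
        · rw [hg1 v h1 h2]; exact hv
    have hgQ : ∀ v ∈ Q, g v ∉ A := by
      intro v hv
      have h3 := (mem_filter.1 hv).2
      rw [hg1 v (fun h => h3 (h ▸ hTA hzT)) fun h => h3 (hT₁A _ h)]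
      exact h3
    have hnQ : ∀ v ∈ S, v ∉ Q → f v ∈ A := by
      intro v hv h
      by_contra hcon
      exact h (mem_filter.2 ⟨hv, hcon⟩)
    set F : V → ℕ := fun v => if v = y then f z else if v ∈ Q then h v else g v with hF
    have Fy : F y = f z := by simp [hF]
    have FQ : ∀ v, v ≠ y → v ∈ Q → F v = h v := fun v h1 h2 => by simp [hF, h1, h2]
    have FA : ∀ v, v ∉ Q → F v = g v := fun v h2 => by
      have h1 : v ≠ y := fun h => h2 (h ▸ hy)
      simp [hF, h1, h2]
    have hhB : ∀ v ∈ Q, v ≠ y → h v ∈ B := fun v h1 h2 => hh.mem v (mem_erase.2 ⟨h2, h1⟩)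
    have key : ∀ v ∈ S, G.Adj y v → F v ≠ f z := by
      intro v hv hyv hFv
      by_cases hvQ : v ∈ Q
      · rw [FQ v hyv.ne' hvQ] at hFv
        exact hdisj _ (hTA hzT) (hFv ▸ hhB v hvQ hyv.ne')
      · rw [FA v hvQ] at hFv
        have h1 : v ∈ ({u ∈ S | g u = f z} : Finset V) := by simp [hv, hFv]
        rw [hgW] at h1
        simp only [mem_erase, mem_filter] at h1
        have h2 : v ∈ ({w ∈ S | f w = f z ∧ G.Adj y w} : Finset V) := by
          simp [hv, h1.2.2, hyv]
        rw [hsolo] at h2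
        exact h1.1 (mem_singleton.1 h2)
    have hFA : ∀ v ∈ S, v ∉ Q → F v ∈ A := fun v hv hvQ => by
      rw [FA v hvQ]; exact hgA v (hnQ v hv hvQ)
    refine ⟨F, ⟨fun v hv => ?_, fun u hu v hv huv => ?_⟩, fun c hc => ?_⟩
    · by_cases h1 : v = y
      · rw [h1, Fy]; exact hAC (hTA hzT)
      · by_cases h2 : v ∈ Q
        · rw [FQ v h1 h2]; exact hBC (hhB v h2 h1)
        · exact hAC (hFA v hv h2)
    · by_cases h1 : u = y
      · subst h1; rw [Fy]; exact (key v hv huv).symm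
      by_cases h2 : v = y
      · subst h2; rw [Fy]; exact key u hu huv.symm
      by_cases h3 : u ∈ Q <;> by_cases h4 : v ∈ Q
      · rw [FQ u h1 h3, FQ v h2 h4]
        exact hh.ne u (mem_erase.2 ⟨h1, h3⟩) v (mem_erase.2 ⟨h2, h4⟩) huv
      · intro h5
        rw [FQ u h1 h3] at h5
        exact hdisj _ (hFA v hv h4) (h5 ▸ hhB u h3 h1)
      · intro h5
        rw [FQ v h2 h4] at h5
        exact hdisj _ (hFA u hu h3) (h5 ▸ hhB v h4 h2)
      · rw [FA u h3, FA v h4]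
        exact hg3 u hu v hv huv
    · by_cases hcA : c ∈ A
      · by_cases hcW : c = f z
        · have : ({v ∈ S | F v = c} : Finset V) =
              insert y (({u ∈ S | f u = f z} : Finset V).erase z) := by
            rw [← hgW, hcW]
            ext v
            simp only [mem_filter, mem_insert]
            by_cases h1 : v = y
            · simp [h1, Fy, hQS hy]
            · by_cases h2 : v ∈ Q
              · have h3 : h v ≠ f z := fun h => hdisj _ (hTA hzT) (h ▸ hhB v h2 h1)
                have h4 : g v ≠ f z := fun h => hgQ v h2 (h ▸ hTA hzT)
                simp [FQ v h1 h2, h3, h4, h1]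
              · simp [FA v h2, h1]
          rw [this, card_insert_of_notMem, card_erase_of_mem (by simp [hz]), hTcls _ hzT]
          · have : 0 < #{v ∈ S | f v = f z} := card_pos.2 ⟨z, by simp [hz]⟩
            rw [hTcls _ hzT] at this
            omega
          · intro h1
            simp only [mem_erase, mem_filter] at h1
            exact (mem_filter.1 hy).2 (h1.2.2 ▸ hTA hzT)
        · have : ({v ∈ S | F v = c} : Finset V) = {v ∈ S | g v = c} := by
            ext v
            simp only [mem_filter]
            by_cases h1 : v = y
            · have h4 : g v ≠ c := fun h => hgQ v (h1 ▸ hy) (h ▸ hcA)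
              have h5 : F v ≠ c := by rw [h1, Fy]; exact Ne.symm hcW
              simp [h4, h5]
            · by_cases h2 : v ∈ Q
              · have h3 : h v ≠ c := fun h => hdisj _ hcA (h ▸ hhB v h2 h1)
                have h4 : g v ≠ c := fun h => hgQ v h2 (h ▸ hcA)
                simp [FQ v h1 h2, h3, h4]
              · simp [FA v h2]
          rw [this]
          by_cases hcT : c ∈ T₁
          · rw [hg4 c hcT]
            split_ifs with h1
            · rw [h1, hsa]
            · exact hclsA c hcA h1
          · rw [filter_shift_eq_erase hgT hg1 hg2 hcT,
              erase_eq_of_notMem (by simp [Ne.symm hcW])]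
            exact hclsA c hcA fun h => hcT (h ▸ hT₁.start_mem)
      · have hcB := hor c hc hcA
        rw [← hhs c hcB]
        congr 1
        ext v
        simp only [mem_filter, mem_erase]
        by_cases h1 : v = y
        · have : F y ≠ c := by rw [Fy]; exact fun h => hcA (h ▸ hTA hzT)
          simp [this, h1]
        · by_cases h2 : v ∈ Q
          · simp [FQ v h1 h2, h1, h2, hQS h2]
          · have : v ∈ S → F v ≠ c := fun h3 h => hcA (h ▸ hFA v h3 h2)
            simp only [h2, and_false, false_and, iff_false, not_and]
            exact this
  push Not at hcase
  obtain ⟨W₀, hW₀⟩ := hTne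
  -- Now solo vertices have neighbours in all other accessible classes, hence at most n neighbours
  -- in `Q`, and the double count applies to any class of `T`.
  have hnT : n < #T := by
    refine lt_of_solo_degree_le (G := G) (hTcls W₀ hW₀) hQcard ?_ ?_ ?_
    · intro y hy
      obtain ⟨w, hw, hwc, hyw⟩ := hQadj y hy W₀ (hTA hW₀)
      exact ⟨w, by simp [hw, hwc], hyw⟩
    · intro z hz y hy hsolo
      obtain ⟨hzS, rfl⟩ := mem_filter.1 hz
      rw [filter_filter] at hsolo
      exact hzdeg' z hzS hW₀ fun X hX hXz => hcase z hzS hW₀ y hy hsolo X hX hXz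
    · intro z hz
      obtain ⟨hzS, rfl⟩ := mem_filter.1 hz
      exact hzdeg z hzS hW₀
  obtain ⟨z, hz, hzT, y₁, hy₁, y₂, hy₂, hne, hnadj, hs₁, hs₂⟩ :=
    exists_shared_solo (G := G) (S := S) (f := f) hnT.le hTcls hQcard hQdeg (by
      intro y hy
      have h1 := card_neighbors_eq_sum (S := S) (f := f) (G := G) A y
      have h2 := hdeg y (hQS hy)
      have hQf : #{w ∈ S | f w ∉ A ∧ G.Adj y w} = #{w ∈ Q | G.Adj y w} := by
        rw [hQ, filter_filter]
      rw [hQf] at h1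
      have h3 : ∑ c ∈ A, (1 + if c ∈ T ∧ #{w ∈ S | f w = c ∧ G.Adj y w} ≠ 1 then 1 else 0) ≤
          ∑ c ∈ A, #{w ∈ S | f w = c ∧ G.Adj y w} := by
        refine sum_le_sum fun c hc => ?_
        have : 0 < #{w ∈ S | f w = c ∧ G.Adj y w} := by
          obtain ⟨w, hw⟩ := hQadj y hy c hc
          exact card_pos.2 ⟨w, by simpa using hw⟩
        split_ifs with h
        · have := h.2; omega
        · omega
      rw [sum_add_distrib, ← card_filter, ← filter_filter, filter_mem_eq_inter,
        inter_eq_right.2 hTA] at h3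
      have h4 := card_filter_add_card_filter_not (s := T)
        (fun c => #{w ∈ S | f w = c ∧ G.Adj y w} = 1)
      simp only [sum_const, smul_eq_mul, mul_one] at h3
      simp only [ne_eq] at h3
      omega)
  have hzX : ∀ X ∈ A, X ≠ f z → ∃ w ∈ S, f w = X ∧ G.Adj z w := fun X hX hXz =>
    hcase z hz hzT y₁ hy₁ hs₁ X hX hXz
  have haW : a ≠ f z := fun h => haT (h ▸ hzT)
  have hzy₁ : G.Adj z y₁ := by
    have : z ∈ ({w ∈ S | f w = f z ∧ G.Adj y₁ w} : Finset V) := by rw [hs₁]; simp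
    exact (mem_filter.1 this).2.2.symm
  obtain ⟨h, hh, hhs⟩ := hIH y₁ hy₁
  -- At most n neighbours of `z` lie in `Q` and one of them is `y₁`, so one of the n colours of `B`
  -- is free for `z`.
  obtain ⟨b, hb, hbz⟩ : ∃ b ∈ B, ∀ w ∈ Q.erase y₁, h w = b → ¬ G.Adj z w := by
    refine exists_color_no_neighbor h ?_
    have h1 := hzdeg' z hz hzT hzX
    have h2 : ({w ∈ Q.erase y₁ | G.Adj z w} : Finset V) =
        ({w ∈ Q | G.Adj z w} : Finset V).erase y₁ := by
      ext w; simp only [mem_filter, mem_erase]; tauto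
    have h3 : y₁ ∈ ({w ∈ Q | G.Adj z w} : Finset V) := by simp [hy₁, hzy₁]
    have h4 : 0 < #{w ∈ Q | G.Adj z w} := card_pos.2 ⟨_, h3⟩
    rw [h2, card_erase_of_mem h3, hn]
    omega
  have hzQ : z ∉ Q := fun h => (mem_filter.1 h).2 (hTA hzT)
  have hnQ : ∀ v ∈ S, v ∉ Q → f v ∈ A := by
    intro v hv h
    by_contra hcon
    exact h (mem_filter.2 ⟨hv, hcon⟩)
  have hzy₁' : z ≠ y₁ := fun h => hzQ (h ▸ hy₁)
  -- `y₁` replaces `z` in its class and `z` joins class `b`, which becomes the new class of size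
  -- s+1.
  set F : V → ℕ := fun v => if v = y₁ then f z else if v = z then b else
    if v ∈ Q then h v else f v with hF
  have Fy : F y₁ = f z := by simp [hF]
  have Fz : F z = b := by simp [hF, hzy₁']
  have FQ : ∀ v, v ≠ y₁ → v ∈ Q → F v = h v := fun v h1 h2 => by
    have : v ≠ z := fun h => hzQ (h ▸ h2)
    simp [hF, h1, h2, this]
  have FA : ∀ v, v ∉ Q → v ≠ z → F v = f v := fun v h2 h3 => by
    have h1 : v ≠ y₁ := fun h => h2 (h ▸ hy₁)
    simp [hF, h1, h2, h3]
  have hhB : ∀ v ∈ Q, v ≠ y₁ → h v ∈ B := fun v h1 h2 => hh.mem v (mem_erase.2 ⟨h2, h1⟩)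
  have hFW : ∀ v ∈ S, F v = f z → v = y₁ ∨ (f v = f z ∧ v ≠ z) := by
    intro v hv hFv
    by_cases h1 : v = y₁
    · exact .inl h1
    · by_cases h2 : v = z
      · rw [h2, Fz] at hFv
        exact absurd hb (hFv ▸ hdisj _ (hTA hzT))
      · by_cases h3 : v ∈ Q
        · rw [FQ v h1 h3] at hFv
          exact absurd (hhB v h3 h1) (hFv ▸ hdisj _ (hTA hzT))
        · exact .inr ⟨by rw [← FA v h3 h2, hFv], h2⟩
  have hFb : ∀ v ∈ S, F v ∈ B → v = z ∨ (v ∈ Q ∧ v ≠ y₁) := by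
    intro v hv hFv
    by_cases h1 : v = y₁
    · rw [h1, Fy] at hFv
      exact absurd hFv (hdisj _ (hTA hzT))
    · by_cases h2 : v = z
      · exact .inl h2
      · by_cases h3 : v ∈ Q
        · exact .inr ⟨h3, h1⟩
        · rw [FA v h3 h2] at hFv
          exact absurd hFv (hdisj _ (hnQ v hv h3))
  have hFA : ∀ v ∈ S, ∀ c ∈ A, c ≠ f z → (F v = c ↔ f v = c) := by
    intro v hv c hc hcz
    by_cases h1 : v = y₁
    · have : f v ≠ c := fun h => (mem_filter.1 hy₁).2 (by rw [← h1, h]; exact hc)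
      rw [h1, Fy, ← h1]
      simp [this, Ne.symm hcz]
    · by_cases h2 : v = z
      · have : b ≠ c := fun h => hdisj c hc (h ▸ hb)
        rw [h2, Fz]
        simp [this, Ne.symm hcz]
      · by_cases h3 : v ∈ Q
        · have h4 : f v ≠ c := fun h => (mem_filter.1 h3).2 (h ▸ hc)
          have h5 : h v ≠ c := fun h => hdisj c hc (h ▸ hhB v h3 h1)
          simp [FQ v h1 h3, h4, h5]
        · simp [FA v h3 h2]
  have hsolo' : ∀ y, ({w ∈ S | f w = f z ∧ G.Adj y w} : Finset V) = {z} → ∀ v ∈ S,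
      f v = f z → v ≠ z → ¬ G.Adj y v := by
    intro y hy v hv hvz hne hadj
    have : v ∈ ({w ∈ S | f w = f z ∧ G.Adj y w} : Finset V) := by simp [hv, hvz, hadj]
    rw [hy] at this
    exact hne (mem_singleton.1 this)
  have keyy : ∀ v ∈ S, G.Adj y₁ v → F v ≠ f z := by
    intro v hv hyv hFv
    rcases hFW v hv hFv with h1 | ⟨h1, h2⟩
    · exact hyv.ne' h1
    · exact hsolo' y₁ hs₁ v hv h1 h2 hyv
  have keyz : ∀ v ∈ S, G.Adj z v → F v ≠ b := by
    intro v hv hzv hFv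
    rcases hFb v hv (hFv ▸ hb) with h1 | ⟨h1, h2⟩
    · exact hzv.ne' h1
    · exact hbz v (mem_erase.2 ⟨h2, h1⟩) (by rw [← FQ v h2 h1, hFv]) hzv
  have hFp : IsProperOn G S C F := by
    refine ⟨fun v hv => ?_, fun u hu v hv huv => ?_⟩
    · by_cases h1 : v = y₁
      · rw [h1, Fy]; exact hAC (hTA hzT)
      · by_cases h2 : v = z
        · rw [h2, Fz]; exact hBC hb
        · by_cases h3 : v ∈ Q
          · rw [FQ v h1 h3]; exact hBC (hhB v h3 h1)
          · rw [FA v h3 h2]; exact hf.mem v hv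
    · by_cases h1 : u = y₁
      · subst h1; rw [Fy]; exact (keyy v hv huv).symm
      by_cases h2 : v = y₁
      · subst h2; rw [Fy]; exact keyy u hu huv.symm
      by_cases h1' : u = z
      · subst h1'; rw [Fz]; exact (keyz v hv huv).symm
      by_cases h2' : v = z
      · subst h2'; rw [Fz]; exact keyz u hu huv.symm
      by_cases h3 : u ∈ Q <;> by_cases h4 : v ∈ Q
      · rw [FQ u h1 h3, FQ v h2 h4]
        exact hh.ne u (mem_erase.2 ⟨h1, h3⟩) v (mem_erase.2 ⟨h2, h4⟩) huv
      · rw [FQ u h1 h3, FA v h4 h2']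
        exact fun h5 => hdisj _ (hnQ v hv h4) (h5 ▸ hhB u h3 h1)
      · rw [FQ v h2 h4, FA u h3 h1']
        exact fun h5 => hdisj _ (hnQ u hu h3) (h5 ▸ hhB v h4 h2)
      · rw [FA u h3 h1', FA v h4 h2']
        exact hf.ne u hu v hv huv
  have hFsame : ∀ c ∈ A, c ≠ f z → ({v ∈ S | F v = c} : Finset V) = {v ∈ S | f v = c} :=
    fun c hc hcz => filter_congr fun v hv => hFA v hv c hc hcz
  have hFcardB : ∀ c ∈ B, c ≠ b → #{v ∈ S | F v = c} = s := by
    intro c hc hcb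
    rw [← hhs c hc]
    congr 1
    ext v
    simp only [mem_filter, mem_erase]
    constructor
    · rintro ⟨hv, rfl⟩
      rcases hFb v hv hc with h1 | ⟨h1, h2⟩
      · rw [h1, Fz] at hcb; exact absurd rfl hcb
      · exact ⟨⟨h2, h1⟩, (FQ v h2 h1).symm⟩
    · rintro ⟨⟨h1, h2⟩, h3⟩
      exact ⟨hQS h2, by rw [FQ v h1 h2, h3]⟩
  have hFcardb : #{v ∈ S | F v = b} = s + 1 := by
    have : ({v ∈ S | F v = b} : Finset V) = insert z {v ∈ Q.erase y₁ | h v = b} := by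
      ext v
      simp only [mem_filter, mem_erase, mem_insert]
      constructor
      · rintro ⟨hv, hFv⟩
        rcases hFb v hv (hFv ▸ hb) with h1 | ⟨h1, h2⟩
        · exact .inl h1
        · exact .inr ⟨⟨h2, h1⟩, by rw [← FQ v h2 h1, hFv]⟩
      · rintro (h1 | ⟨⟨h1, h2⟩, h3⟩)
        · rw [h1]; exact ⟨hz, Fz⟩
        · exact ⟨hQS h2, by rw [FQ v h1 h2, h3]⟩
    rw [this, card_insert_of_notMem (by simp [hzQ]), hhs b hb]
  have hFcardW : #{v ∈ S | F v = f z} = s := by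
    have : ({v ∈ S | F v = f z} : Finset V) =
        insert y₁ (({v ∈ S | f v = f z} : Finset V).erase z) := by
      ext v
      simp only [mem_filter, mem_erase, mem_insert]
      constructor
      · rintro ⟨hv, hFv⟩
        rcases hFW v hv hFv with h1 | ⟨h1, h2⟩
        · exact .inl h1
        · exact .inr ⟨h2, hv, h1⟩
      · rintro (h1 | ⟨h1, h2, h3⟩)
        · rw [h1]; exact ⟨hQS hy₁, Fy⟩
        · refine ⟨h2, ?_⟩
          rw [FA v (fun h => (mem_filter.1 h).2 (h3 ▸ hTA hzT)) h1, h3]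
    rw [this, card_insert_of_notMem, card_erase_of_mem (by simp [hz]), hTcls _ hzT]
    · have : 0 < #{v ∈ S | f v = f z} := card_pos.2 ⟨z, by simp [hz]⟩
      rw [hTcls _ hzT] at this
      omega
    · intro h1
      simp only [mem_erase, mem_filter] at h1
      exact (mem_filter.1 hy₁).2 (h1.2.2 ▸ hTA hzT)
  have hacc : ∀ c ∈ A, c ≠ f z →
      ReflTransGen (fun e d => d ∈ C ∧ Movable G S F d e) a c := by
    intro c hc hcz
    have := hterm _ hzT c hc hcz
    clear hc hcz
    induction this with
    | refl => exact .refl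
    | @tail e d he hr ih =>
      refine ih.tail ⟨hr.1.1, ?_⟩
      obtain ⟨v, hv, hvd, hve⟩ := hr.1.2
      have heA := havA _ _ he
      have hdA := havA _ _ (he.tail hr)
      exact ⟨v, hv, (hFA v hv d hdA hr.2.2).2 hvd, fun w hw hwe =>
        hve w hw ((hFA w hw e heA hr.2.1).1 hwe)⟩
  -- The vertex witnessing the last step into the class of `z` is not `z`, which has neighbours in
  -- every other accessible class; so that vertex is still there.
  have haccW : ReflTransGen (fun e d => d ∈ C ∧ Movable G S F d e) a (f z) := by
    obtain ⟨T₁, hT₁⟩ := SimpleWalk.of_reflTransGen (mem_filter.1 (hTA hzT)).2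
    generalize hx : f z = x at hT₁
    cases hT₁ with
    | single => exact absurd hx.symm haW
    | @snoc T₁ d _ hT₁ hr hpT =>
      subst hx
      have hdA : d ∈ A := hRA d hT₁.reflTransGen
      have hdz : d ≠ f z := fun h => hpT (h ▸ hT₁.end_mem)
      refine (hacc d hdA hdz).tail ⟨hr.1, ?_⟩
      obtain ⟨w, hw, hwz, hwd⟩ := hr.2
      have hwz' : w ≠ z := by
        rintro rfl
        obtain ⟨u, hu, hud, hadj⟩ := hzX d hdA hdz
        exact hwd u hu hud hadj
      refine ⟨w, hw, ?_, fun u hu hud => hwd u hu ((hFA u hu d hdA hdz).1 hud)⟩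
      rw [FA w (fun h => (mem_filter.1 h).2 (hwz ▸ hTA hzT)) hwz', hwz]
  -- The only neighbour of `y₂` in that class was `z`, which has left, and the newcomer `y₁` is not
  -- adjacent to `y₂`. So `y₂` makes its own class, formerly counted in `B`, accessible.
  have hacc2 : ReflTransGen (fun e d => d ∈ C ∧ Movable G S F d e) a (h y₂) := by
    refine haccW.tail ⟨hBC (hhB y₂ hy₂ hne.symm), y₂, hQS hy₂, FQ y₂ hne.symm hy₂, ?_⟩
    intro w hw hFw hadj
    rcases hFW w hw hFw with h1 | ⟨h1, h2⟩
    · exact hnadj (h1 ▸ hadj.symm)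
    · exact hsolo' y₂ hs₂ w hw h1 h2 hadj
  refine ihn _ ?_ F a b hFp ha (hBC hb) (fun h => hdisj a haA (h ▸ hb)) ?_ hFcardb ?_ rfl
  · rw [← hn]
    refine card_lt_card ((ssubset_iff_of_subset ?_).2 ⟨h y₂, hhB y₂ hy₂ hne.symm, ?_⟩)
    · intro c hc
      obtain ⟨hcC, hc⟩ := mem_filter.1 hc
      refine hor c hcC fun hcA => hc ?_
      by_cases hcz : c = f z
      · rw [hcz]; exact haccW
      · exact hacc c hcA hcz
    · simp [hacc2]
  · rw [hFsame a haA haW, hsa]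
  · intro c hc hca hcb
    by_cases hcA : c ∈ A
    · by_cases hcz : c = f z
      · rw [hcz, hFcardW]
      · rw [hFsame c hcA hcz]; exact hclsA c hcA hca
    · exact hFcardB c (hor c hc hcA) hcb

/-! ### The Hajnal–Szemerédi theorem -/

/-- The Hajnal–Szemerédi theorem. -/
theorem equitablyColorable {V : Type*} (k : ℕ) :
    ∀ (G : SimpleGraph V) (S : Finset V) (s : ℕ) (C : Finset ℕ), #C = k → #S = k * s →
      (∀ v ∈ S, #{w ∈ S | G.Adj v w} < k) → EquitablyColorable G S C s := by
  induction k using Nat.strong_induction_on with | _ k ih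
  intro G S s C hC hS hdeg
  -- `GT T` keeps only the edges inside `T`, so enlarging `T` by `u` creates conflicts only at `u`.
  -- Recolouring `u` alone then gives a nearly equitable colouring.
  obtain ⟨GT, hGT⟩ : ∃ GT : Finset V → SimpleGraph V,
      ∀ T u v, (GT T).Adj u v ↔ G.Adj u v ∧ u ∈ T ∧ v ∈ T :=
    ⟨fun T =>
      { Adj := fun u v => G.Adj u v ∧ u ∈ T ∧ v ∈ T
        symm := ⟨fun u v h => ⟨h.1.symm, h.2.2, h.2.1⟩⟩
        loopless := ⟨fun u h => h.1.ne rfl⟩ }, fun _ _ _ => Iff.rfl⟩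
  suffices h : ∀ T : Finset V, T ⊆ S → EquitablyColorable (GT T) S C s by
    obtain ⟨f, hf, hfs⟩ := h S subset_rfl
    exact ⟨f, ⟨hf.mem, fun u hu v hv huv => hf.ne u hu v hv ((hGT S u v).2 ⟨huv, hu, hv⟩)⟩, hfs⟩
  intro T
  induction T using Finset.induction_on with
  | empty =>
    intro _
    have hcard : Fintype.card S = Fintype.card (C × Fin s) := by simp [hS, hC]
    have e := Fintype.equivOfCardEq hcard
    refine ⟨fun v => if h : v ∈ S then (e ⟨v, h⟩).1 else 0, ⟨fun v hv => ?_, ?_⟩, fun c hc => ?_⟩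
    · simp [hv]
    · intro u _ v _ h
      simp [hGT] at h
    · have : #(univ : Finset (Fin s)) = s := by simp
      refine Eq.trans (Eq.symm ?_) this
      refine card_bij (fun i _ => ((e.symm (⟨c, hc⟩, i) : S) : V)) ?_ ?_ ?_
      · intro i _
        simp
      · intro i _ j _ h
        simpa using h
      · intro v hv
        obtain ⟨hv, hvc⟩ := mem_filter.1 hv
        simp only [dif_pos hv] at hvc
        refine ⟨(e ⟨v, hv⟩).2, mem_univ _, ?_⟩
        have : ((⟨c, hc⟩, (e ⟨v, hv⟩).2) : C × Fin s) = e ⟨v, hv⟩ := by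
          ext
          · exact hvc.symm
          · rfl
        rw [this]
        simp
  | insert u T huT ihT =>
    intro hT
    obtain ⟨huS, hTS⟩ := insert_subset_iff.1 hT
    obtain ⟨f, hf, hfs⟩ := ihT hTS
    have hdegT : ∀ T, ∀ v ∈ S, #{w ∈ S | (GT T).Adj v w} < k := fun T v hv =>
      (card_le_card (monotone_filter_right S fun w _ h => ((hGT T v w).1 h).1)).trans_lt (hdeg v hv)
    obtain ⟨b, hb, hbu⟩ := exists_color_no_neighbor (G := G) (Q := S) (C := C) (v := u) f
      (hC ▸ hdeg u huS)
    have hprop : IsProperOn (GT (insert u T)) S C (Function.update f u b) := by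
      refine ⟨fun v hv => ?_, fun v hv w hw h => ?_⟩
      · by_cases h : v = u
        · simp [h, hb]
        · simpa [h] using hf.mem v hv
      · rw [hGT] at h
        by_cases h1 : v = u
        · subst h1
          have h2 : w ≠ v := h.1.ne'
          simp only [Function.update_self, Function.update_of_ne h2]
          exact fun h3 => hbu w hw h3.symm h.1
        · by_cases h2 : w = u
          · subst h2
            simp only [Function.update_self, Function.update_of_ne h1]
            exact fun h3 => hbu v hv h3 h.1.symm
          · simp only [Function.update_of_ne h1, Function.update_of_ne h2]
            exact hf.ne v hv w hw ((hGT T v w).2 ⟨h.1, (mem_insert.1 h.2.1).resolve_left h1,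
              (mem_insert.1 h.2.2).resolve_left h2⟩)
    by_cases hbf : f u = b
    · rw [← hbf, Function.update_eq_self] at hprop
      exact ⟨f, hprop, hfs⟩
    · have hs0 : 0 < s := by
        rw [← hfs (f u) (hf.mem u huS)]
        exact card_pos.2 ⟨u, by simp [huS]⟩
      refine EquitablyColorable.of_nearly (fun q hq => ih q hq _) hC (hdegT (insert u T)) _
        (Function.update f u b) (f u) b hprop (hf.mem u huS) hb hbf ?_ ?_ ?_ rfl
      · have : ({v ∈ S | Function.update f u b v = f u} : Finset V) =
            ({v ∈ S | f v = f u} : Finset V).erase u := by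
          ext v
          by_cases h : v = u
          · subst h; simp [Ne.symm hbf]
          · simp [h]
        rw [this, card_erase_of_mem (by simp [huS]), hfs _ (hf.mem u huS)]
        omega
      · have : ({v ∈ S | Function.update f u b v = b} : Finset V) =
            insert u ({v ∈ S | f v = b} : Finset V) := by
          ext v
          by_cases h : v = u
          · subst h; simp [huS]
          · simp [h]
        rw [this, card_insert_of_notMem (by simp [hbf]), hfs _ hb]
      · intro c hc hcu hcb
        rw [← hfs c hc]
        congr 1
        ext v
        by_cases h : v = u
        · subst h; simp [Ne.symm hcu, Ne.symm hcb]
        · simp [h]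

/-- A graph on at most `r * k` vertices of maximum degree less than `k` has a proper `k`-colouring
with at most `r` vertices of each colour. -/
theorem exists_coloring_card_le {V : Type*} [Fintype V] (G : SimpleGraph V) {k r : ℕ}
    (hdeg : ∀ v, #{w | G.Adj v w} < k) (hcard : Fintype.card V ≤ r * k) :
    ∃ f : V → Fin k, (∀ u v, G.Adj u v → f u ≠ f v) ∧ ∀ c, #{v | f v = c} ≤ r := by
  -- Isolated vertices pad the graph to exactly r·k vertices; restricting to `V` only shrinks the
  -- classes.
  let W := V ⊕ Fin (r * k - Fintype.card V)
  rcases isEmpty_or_nonempty V with hV | ⟨⟨v₀⟩⟩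
  · exact ⟨isEmptyElim, fun u => isEmptyElim u, fun c => by simp⟩
  have hk : 0 < k := (Nat.zero_le _).trans_lt (hdeg v₀)
  obtain ⟨f, hf, hfs⟩ := equitablyColorable k (G ⊕g (⊥ : SimpleGraph (Fin (r * k - Fintype.card V))))
    univ r (range k) (by simp) (by simp only [card_univ, Fintype.card_sum, Fintype.card_fin]; rw [mul_comm k r]; omega) (by
      rintro (v | v) -
      · have : ({w | (G ⊕g (⊥ : SimpleGraph (Fin (r * k - Fintype.card V)))).Adj (.inl v) w} :
            Finset W) = ({w | G.Adj v w} : Finset V).map ⟨Sum.inl, Sum.inl_injective⟩ := by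
          ext (w | w) <;> simp
        rw [this, card_map]
        exact hdeg v
      · have : ({w | (G ⊕g (⊥ : SimpleGraph (Fin (r * k - Fintype.card V)))).Adj (.inr v) w} :
            Finset W) = ∅ := by
          ext (w | w) <;> simp
        rw [this]
        simpa using hk)
  refine ⟨fun v => ⟨f (.inl v), mem_range.1 (hf.mem _ (mem_univ _))⟩, fun u v huv h => ?_,
    fun c => ?_⟩
  · exact hf.ne (.inl u) (mem_univ _) (.inl v) (mem_univ _) (by simpa using huv)
      (congrArg Fin.val h)
  · refine le_trans ?_ (hfs c (mem_range.2 c.2)).le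
    rw [← card_map (⟨Sum.inl, Sum.inl_injective⟩ : V ↪ W)]
    refine card_le_card fun w hw => ?_
    simp only [mem_map, mem_filter, mem_univ, true_and] at hw ⊢
    obtain ⟨v, rfl, rfl⟩ := hw
    rfl

end EquitableColoring

/-! ### Partial edge colourings avoiding vertex colours: fan shifts and exchanges -/

section ConstrainedEdgeColoring

open Classical Finset Relation

variable {V K : Type*} {G : SimpleGraph V} {c : V → Option K} {φ ψ : V → V → Option K}

/-- A partial proper edge colouring of `G` in which no edge at `v` has colour `c v`. -/
structure IsPartialEdgeColoring (G : SimpleGraph V) (c : V → Option K) (φ : V → V → Option K) :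
    Prop where
  symm : ∀ u v, φ u v = φ v u
  adj : ∀ u v a, φ u v = some a → G.Adj u v
  inj : ∀ u v w a, φ u v = some a → φ u w = some a → v = w
  avoid : ∀ u v a, φ u v = some a → c u ≠ some a

/-- The colour `a` is neither the colour of `v` nor of an edge at `v`. -/
def Missing (c : V → Option K) (φ : V → V → Option K) (v : V) (a : K) : Prop :=
  (∀ w, φ v w ≠ some a) ∧ c v ≠ some a

/-- Change the colour of the edge `xy` to `o`. -/
noncomputable def setEdge (φ : V → V → Option K) (x y : V) (o : Option K) : V → V → Option K :=
  fun u v => if (u = x ∧ v = y) ∨ (u = y ∧ v = x) then o else φ u v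

/-- The number of ordered pairs of vertices joined by a coloured edge. -/
noncomputable def coloredCount [Fintype V] (φ : V → V → Option K) : ℕ :=
  #{p : V × V | (φ p.1 p.2).isSome}

/-- `φ` has as many coloured edges as possible and the edge `xy` is uncoloured. -/
structure IsMaxUncolored [Fintype V] (G : SimpleGraph V) (c : V → Option K)
    (φ : V → V → Option K) (x y : V) : Prop where
  isPartial : IsPartialEdgeColoring G c φ
  max : ∀ ψ, IsPartialEdgeColoring G c ψ → coloredCount ψ ≤ coloredCount φ
  adj : G.Adj x y
  uncolored : φ x y = none

/-- The edge `xb` has a colour that is missing at `a`. -/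
def FanRel (c : V → Option K) (φ : V → V → Option K) (x a b : V) : Prop :=
  ∃ γ, Missing c φ a γ ∧ φ x b = some γ

theorem setEdge_apply_left {x y : V} (hxy : x ≠ y) (o : Option K) (w : V) :
    setEdge φ x y o x w = if w = y then o else φ x w := by
  simp [setEdge, hxy]

theorem setEdge_apply_same {x y : V} (o : Option K) : setEdge φ x y o x y = o := by
  simp [setEdge]

theorem setEdge_of_ne {x y u v : V} (o : Option K) (hu : u ≠ x) (hv : v ≠ x) :
    setEdge φ x y o u v = φ u v := by
  simp [setEdge, hu, hv]

theorem setEdge_setEdge {x y : V} (o o' : Option K) :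
    setEdge (setEdge φ x y o) x y o' = setEdge φ x y o' := by
  ext u v
  simp only [setEdge]
  split_ifs <;> rfl

theorem setEdge_eq_self {x y : V} (h : IsPartialEdgeColoring G c φ) :
    setEdge φ x y (φ x y) = φ := by
  funext u v
  simp only [setEdge]
  split_ifs with h1
  · rcases h1 with ⟨rfl, rfl⟩ | ⟨rfl, rfl⟩
    · rfl
    · exact h.symm _ _
  · rfl

theorem IsPartialEdgeColoring.setEdge_none (h : IsPartialEdgeColoring G c φ) (x y : V) :
    IsPartialEdgeColoring G c (setEdge φ x y none) := by
  have key : ∀ u v a, setEdge φ x y none u v = some a → φ u v = some a := by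
    intro u v a
    simp only [setEdge]
    split_ifs <;> simp
  refine ⟨fun u v => ?_, fun u v a hu => h.adj u v a (key _ _ _ hu), fun u v w a hu hv =>
    h.inj u v w a (key _ _ _ hu) (key _ _ _ hv), fun u v a hu => h.avoid u v a (key _ _ _ hu)⟩
  simp only [setEdge]
  rw [h.symm u v]
  congr 1
  exact propext ⟨fun h => h.symm.imp And.symm And.symm, fun h => h.symm.imp And.symm And.symm⟩

theorem IsPartialEdgeColoring.setEdge_some (h : IsPartialEdgeColoring G c φ) {x y : V} {a : K}
    (hxy : G.Adj x y) (hx : Missing c φ x a) (hy : Missing c φ y a) :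
    IsPartialEdgeColoring G c (setEdge φ x y (some a)) := by
  refine ⟨fun u v => ?_, fun u v b hu => ?_, fun u v w b hu hv => ?_, fun u v b hu => ?_⟩
  · simp only [setEdge]
    rw [h.symm u v]
    congr 1
    exact propext ⟨fun h => h.symm.imp And.symm And.symm, fun h => h.symm.imp And.symm And.symm⟩
  · simp only [setEdge] at hu
    split_ifs at hu with h1
    · rcases h1 with ⟨rfl, rfl⟩ | ⟨rfl, rfl⟩
      · exact hxy
      · exact hxy.symm
    · exact h.adj u v b hu
  · simp only [setEdge] at hu hv
    split_ifs at hu hv with h1 h2 h2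
    · rcases h1 with ⟨rfl, rfl⟩ | ⟨rfl, rfl⟩ <;> rcases h2 with ⟨h3, rfl⟩ | ⟨h3, rfl⟩
      · rfl
      · exact absurd h3 hxy.ne
      · exact absurd h3 hxy.ne'
      · rfl
    · obtain rfl := Option.some_injective _ hu
      rcases h1 with ⟨rfl, rfl⟩ | ⟨rfl, rfl⟩
      · exact absurd hv (hx.1 w)
      · exact absurd hv (hy.1 w)
    · obtain rfl := Option.some_injective _ hv
      rcases h2 with ⟨rfl, rfl⟩ | ⟨rfl, rfl⟩
      · exact absurd hu (hx.1 v)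
      · exact absurd hu (hy.1 v)
    · exact h.inj u v w b hu hv
  · simp only [setEdge] at hu
    split_ifs at hu with h1
    · obtain rfl := Option.some_injective _ hu
      rcases h1 with ⟨rfl, rfl⟩ | ⟨rfl, rfl⟩
      · exact hx.2
      · exact hy.2
    · exact h.avoid u v b hu

theorem IsPartialEdgeColoring.missing_setEdge_none {x : V} (h : IsPartialEdgeColoring G c φ) {b : V} {a : K}
    (hb : φ x b = some a) : Missing c (setEdge φ x b none) x a := by
  refine ⟨fun w hw => ?_, h.avoid _ _ _ hb⟩
  rw [setEdge_apply_left (h.adj _ _ _ hb).ne] at hw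
  split_ifs at hw with h1
  exact h1 (h.inj _ _ _ _ hw hb)

section Fintype

variable [Fintype V] {x y : V}

theorem coloredCount_setEdge_some (h : IsPartialEdgeColoring G c φ) (hxy : x ≠ y)
    (hn : φ x y = none) (a : K) : coloredCount (setEdge φ x y (some a)) = coloredCount φ + 2 := by
  have hn' : φ y x = none := by rw [← h.symm, hn]
  have : (univ.filter fun p : V × V => (setEdge φ x y (some a) p.1 p.2).isSome) =
      insert (x, y) (insert (y, x) (univ.filter fun p : V × V => (φ p.1 p.2).isSome)) := by
    ext ⟨u, v⟩
    simp only [mem_filter, mem_univ, true_and, mem_insert, Prod.mk.injEq]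
    simp only [setEdge]
    split_ifs with h1
    · simp only [Option.isSome_some, true_iff]; tauto
    · tauto
  rw [coloredCount, this, card_insert_of_notMem, card_insert_of_notMem]
  · rfl
  · simp [hn']
  · simp [hn, hxy]

namespace IsMaxUncolored

theorem symm (h : IsMaxUncolored G c φ x y) : IsMaxUncolored G c φ y x :=
  ⟨h.isPartial, h.max, h.adj.symm, by rw [h.isPartial.symm, h.uncolored]⟩

theorem not_missing_both (h : IsMaxUncolored G c φ x y) {a : K} (hx : Missing c φ x a)
    (hy : Missing c φ y a) : False := by
  have h1 := h.max _ (h.isPartial.setEdge_some h.adj hx hy)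
  rw [coloredCount_setEdge_some h.isPartial h.adj.ne h.uncolored] at h1
  omega

/-- Moving the uncoloured edge from `xy` to `xb`. -/
theorem shift (h : IsMaxUncolored G c φ x y) {b : V} {a : K} (hy : Missing c φ y a)
    (hb : φ x b = some a) :
    IsMaxUncolored G c (setEdge (setEdge φ x b none) x y (some a)) x b := by
  have hxb := h.isPartial.adj _ _ _ hb
  have hby : b ≠ y := by
    rintro rfl
    simp [h.uncolored] at hb
  have h1 := h.isPartial.setEdge_none x b
  have hn : setEdge φ x b none x y = none := by
    rw [setEdge_apply_left hxb.ne, h.uncolored, ite_self]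
  have hy' : Missing c (setEdge φ x b none) y a := by
    refine ⟨fun w hw => ?_, hy.2⟩
    simp only [setEdge] at hw
    split_ifs at hw
    exact hy.1 w hw
  have h2 := h1.setEdge_some h.adj (h.isPartial.missing_setEdge_none hb) hy'
  have hcount : coloredCount φ = coloredCount (setEdge φ x b none) + 2 := by
    have := coloredCount_setEdge_some h1 hxb.ne (setEdge_apply_same none) a
    rwa [setEdge_setEdge, ← hb, setEdge_eq_self h.isPartial] at this
  refine ⟨h2, fun ψ hψ => ?_, hxb, ?_⟩
  · rw [coloredCount_setEdge_some h1 h.adj.ne hn, ← hcount]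
    exact h.max ψ hψ
  · rw [setEdge_apply_left h.adj.ne, if_neg hby, setEdge_apply_left hxb.ne, if_pos rfl]

/-- Exchanging the colours `α` and `β` on a set closed under edges of these colours. -/
theorem swap (h : IsMaxUncolored G c φ x y) {α β : K} {z : V} {C : Set V} (hz : z ∈ C)
    (hC : ∀ u ∈ C, ∀ v, φ u v = some α ∨ φ u v = some β → v ∈ C)
    (hc : ∀ u ∈ C, c u ≠ some α ∧ c u ≠ some β) (hm : Missing c φ z α) :
    ∃ ψ, IsMaxUncolored G c ψ x y ∧ Missing c ψ z β ∧
      ∀ v ∉ C, ∀ a, Missing c φ v a → Missing c ψ v a := by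
  set ψ : V → V → Option K := fun u v =>
    if u ∈ C then (φ u v).map (Equiv.swap α β) else φ u v with hψ
  have hsome : ∀ u v, (ψ u v).isSome = (φ u v).isSome := by
    intro u v
    simp only [hψ]
    split_ifs <;> simp
  have hin : ∀ u ∈ C, ∀ v a, ψ u v = some a ↔ φ u v = some (Equiv.swap α β a) := by
    intro u hu v a
    simp only [hψ, if_pos hu, Option.map_eq_some_iff]
    constructor
    · rintro ⟨b, hb, rfl⟩; simpa using hb
    · intro hb; exact ⟨_, hb, by simp⟩
  have hout : ∀ u ∉ C, ∀ v, ψ u v = φ u v := fun u hu v => by simp [hψ, hu]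
  -- An edge leaving `C` has neither colour, so the exchange fixes it; this makes `ψ` symmetric.
  have hcross : ∀ u ∈ C, ∀ v ∉ C, (φ u v).map (Equiv.swap α β) = φ u v := by
    intro u hu v hv
    rcases ho : φ u v with _ | a
    · rfl
    · have h1 : a ≠ α := by rintro rfl; exact hv (hC u hu v (.inl ho))
      have h2 : a ≠ β := by rintro rfl; exact hv (hC u hu v (.inr ho))
      simp [Equiv.swap_apply_of_ne_of_ne h1 h2]
  have hP : IsPartialEdgeColoring G c ψ := by
    refine ⟨fun u v => ?_, fun u v a hu => ?_, fun u v w a hu hv => ?_, fun u v a hu => ?_⟩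
    · simp only [hψ]
      split_ifs with h1 h2 h2
      · rw [h.isPartial.symm]
      · rw [hcross u h1 v h2, h.isPartial.symm]
      · rw [hcross v h2 u h1, h.isPartial.symm]
      · exact h.isPartial.symm u v
    · have : (φ u v).isSome := by rw [← hsome, hu]; rfl
      obtain ⟨b, hb⟩ := Option.isSome_iff_exists.1 this
      exact h.isPartial.adj u v b hb
    · by_cases huC : u ∈ C
      · rw [hin u huC] at hu hv
        exact h.isPartial.inj _ _ _ _ hu hv
      · rw [hout u huC] at hu hv
        exact h.isPartial.inj _ _ _ _ hu hv
    · by_cases huC : u ∈ C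
      · rw [hin u huC] at hu
        by_cases h1 : a = α
        · rw [h1]; exact (hc u huC).1
        · by_cases h2 : a = β
          · rw [h2]; exact (hc u huC).2
          · rw [Equiv.swap_apply_of_ne_of_ne h1 h2] at hu
            exact h.isPartial.avoid u v a hu
      · rw [hout u huC] at hu
        exact h.isPartial.avoid u v a hu
  have hcount : coloredCount ψ = coloredCount φ := by
    simp only [coloredCount, hsome]
  refine ⟨ψ, ⟨hP, fun χ hχ => hcount ▸ h.max χ hχ, h.adj, ?_⟩, ⟨fun w hw => ?_, (hc z hz).2⟩, ?_⟩
  · have := hsome x y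
    rw [h.uncolored] at this
    simpa using this
  · rw [hin z hz, Equiv.swap_apply_right] at hw
    exact hm.1 w hw
  · intro v hv a ha
    refine ⟨fun w hw => ?_, ha.2⟩
    rw [hout v hv] at hw
    exact ha.1 w hw

/-- Moving the uncoloured edge along a path of the fan at `x`. -/
theorem exists_shift (h : IsMaxUncolored G c φ x y) {T : Set V} {b : V}
    (hT : SimpleWalk (FanRel c φ x) y T b) :
    ∃ ψ, IsMaxUncolored G c ψ x b ∧ (∀ u v, u ≠ x → v ≠ x → ψ u v = φ u v) ∧
      (∀ v ∉ T, ψ x v = φ x v) ∧ (∀ a, Missing c ψ x a ↔ Missing c φ x a) ∧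
      (∀ a, Missing c φ b a → Missing c ψ b a) ∧
      (∀ α, (∀ v ∈ T, φ x v ≠ some α) → ∀ v, ψ x v = some α ↔ φ x v = some α) ∧
      ∀ α, (∃ v ∈ T, φ x v = some α) → ∃ p T', SimpleWalk (FanRel c φ x) y T' p ∧
        (∀ v ∈ T', φ x v ≠ some α) ∧ Missing c φ p α ∧ ψ x p = some α := by
  induction hT with
  | single =>
    exact ⟨φ, h, fun _ _ _ _ => rfl, fun _ _ => rfl, fun _ => Iff.rfl, fun _ h => h,
      fun _ _ _ => Iff.rfl, fun α ⟨v, hv, hα⟩ => by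
        rw [Set.mem_singleton_iff.1 hv, h.uncolored] at hα; simp at hα⟩
  | @snoc T p d hT hr hd ih =>
    obtain ⟨ψ, h1, h2, h3, h4, h5, h6, h7⟩ := ih
    obtain ⟨γ, hpγ, hdγ⟩ := hr
    have hψd : ψ x d = some γ := by rw [h3 d hd, hdγ]
    have hxp := h1.adj
    have hs := h1.shift (h5 γ hpγ) hψd
    have hxd := hs.adj
    have hpd : p ≠ d := fun h => hd (h ▸ hT.end_mem)
    have hrow : ∀ w, setEdge (setEdge ψ x d none) x p (some γ) x w =
        if w = p then some γ else if w = d then none else ψ x w := by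
      intro w
      rw [setEdge_apply_left hxp.ne, setEdge_apply_left hxd.ne]
    have hother : ∀ u v, u ≠ x → v ≠ x →
        setEdge (setEdge ψ x d none) x p (some γ) u v = φ u v := by
      intro u v hu hv
      rw [setEdge_of_ne _ hu hv, setEdge_of_ne _ hu hv, h2 u v hu hv]
    generalize hψ' : setEdge (setEdge ψ x d none) x p (some γ) = ψ' at hs hrow hother
    have hcol : ∀ a, a ≠ γ → ∀ w, ψ' x w = some a ↔ ψ x w = some a := by
      intro a ha w
      rw [hrow]
      split_ifs with h8 h9
      · rw [h8, h1.uncolored]; simp [ha.symm]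
      · rw [h9, hψd]; simp [ha.symm]
      · rfl
    refine ⟨ψ', hs, hother, fun v hv => ?_, fun a => ?_, fun a ha => ?_, fun α hα v => ?_,
      fun α hα => ?_⟩
    · simp only [Set.mem_insert_iff, not_or] at hv
      have hvp : v ≠ p := fun h => hv.2 (h ▸ hT.end_mem)
      rw [hrow, if_neg hvp, if_neg hv.1, h3 v hv.2]
    · rw [← h4]
      by_cases ha : a = γ
      · subst ha
        constructor
        · intro h; exact absurd (by rw [hrow, if_pos rfl]) (h.1 p)
        · intro h; exact absurd hψd (h.1 d)
      · simp only [Missing, ne_eq, hcol a ha]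
    · refine ⟨fun w hw => ?_, ha.2⟩
      by_cases hwx : w = x
      · rw [hwx, hs.isPartial.symm, hs.uncolored] at hw
        simp at hw
      · rw [hother d w hxd.ne' hwx] at hw
        exact ha.1 w hw
    · have hαγ : α ≠ γ := by
        rintro rfl
        exact hα d (Set.mem_insert _ _) hdγ
      rw [hcol α hαγ, h6 α fun v hv => hα v (Set.mem_insert_of_mem _ hv)]
    · obtain ⟨v, hv, hvα⟩ := hα
      rcases hv with rfl | hv
      · obtain rfl : α = γ := Option.some_injective _ (hvα ▸ hdγ)
        -- The edge of colour `α` at `x` is `xd` itself: the shift transfers `α` to `xp`, and the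
        -- walk up to `p` does not meet that edge.
        refine ⟨p, T, hT, fun u hu hα => ?_, hpγ, by rw [hrow, if_pos rfl]⟩
        exact hd (h.isPartial.inj _ _ _ _ hα hdγ ▸ hu)
      · obtain ⟨p', T', hT', ha, hb, hc'⟩ := h7 α ⟨v, hv, hvα⟩
        have hαγ : α ≠ γ := by
          rintro rfl
          exact hd (h.isPartial.inj _ _ _ _ hvα hdγ ▸ hv)
        exact ⟨p', T', hT', ha, hb, (hcol α hαγ p').2 hc'⟩

end IsMaxUncolored

end Fintype

/-! ### Ends of two-coloured chains -/

/-- A connected component of a graph of maximum degree two has at most two vertices of degree at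
most one. -/
theorem not_reachable_three_ends {V : Type*} [Fintype V] {H : SimpleGraph V}
    (hH : ∀ v, #{w | H.Adj v w} ≤ 2) {a b d : V} (hab : a ≠ b) (had : a ≠ d) (hbd : b ≠ d)
    (ha : #{w | H.Adj a w} ≤ 1) (hb : #{w | H.Adj b w} ≤ 1) (hd : #{w | H.Adj d w} ≤ 1)
    (hrb : H.Reachable a b) (hrd : H.Reachable a d) : False := by
  set C := H.connectedComponentMk a with hC
  have hmem : ∀ v, H.Reachable a v → v ∈ C := fun v hv => ConnectedComponent.sound hv.symm
  have hconn := C.connected_toSimpleGraph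
  have h1 := hconn.card_vert_le_card_edgeSet_add_one
  have h2 := C.toSimpleGraph.sum_degrees_eq_twice_card_edges
  have hdeg : ∀ v : C, C.toSimpleGraph.degree v ≤ #{w | H.Adj v w} := by
    intro v
    rw [← card_neighborFinset_eq_degree]
    refine card_le_card_of_injOn (fun w => (w : V)) (fun w hw => ?_)
      (fun u _ w _ h => Subtype.ext h)
    have : H.Adj v w := (mem_neighborFinset C.toSimpleGraph v w).1 (mem_coe.1 hw)
    simpa using this
  set E : Finset C := {⟨a, hmem a (Reachable.refl _)⟩, ⟨b, hmem b hrb⟩, ⟨d, hmem d hrd⟩} with hE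
  have hE3 : #E = 3 := card_eq_three.2 ⟨_, _, _, by simpa using hab, by simpa using had,
    by simpa using hbd, rfl⟩
  -- Connectedness on m vertices forces degree sum at least 2m−2, while three vertices of degree at
  -- most one leave at most 2m−3.
  have hle : ∑ v : C, C.toSimpleGraph.degree v + #E ≤ ∑ v : C, 2 := by
    rw [show #E = ∑ v : C, if v ∈ E then 1 else 0 by simp, ← sum_add_distrib]
    refine sum_le_sum fun v _ => ?_
    split_ifs with hv
    · have : #{w | H.Adj v w} ≤ 1 := by
        simp only [hE, mem_insert, mem_singleton] at hv
        rcases hv with rfl | rfl | rfl <;> assumption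
      have := hdeg v
      omega
    · exact (hdeg v).trans (hH v)
  rw [Nat.card_eq_fintype_card, Nat.card_eq_fintype_card, ← edgeFinset_card] at h1
  simp only [sum_const, card_univ, smul_eq_mul] at hle
  omega

/-- Ends of paths in a graph of maximum degree two whose other ends lie in `Z` are at most as many as the elements
of `Z`. -/
theorem card_le_of_reachable_ends {V : Type*} [Fintype V] {H : SimpleGraph V} {S Z : Finset V}
    (hH : ∀ v, #{w | H.Adj v w} ≤ 2) (hS : ∀ v ∈ S, #{w | H.Adj v w} ≤ 1)
    (hZ : ∀ v ∈ Z, #{w | H.Adj v w} ≤ 1) (hSZ : Disjoint S Z)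
    (hr : ∀ v ∈ S, ∃ w ∈ Z, H.Reachable v w) : #S ≤ #Z := by
  choose! g hg hgr using hr
  refine card_le_card_of_injOn g hg fun u hu v hv huv => ?_
  by_contra hne
  have h1 := hgr u hu
  have h2 := hgr v hv
  rw [← huv] at h2
  have hgu := hg u hu
  exact not_reachable_three_ends hH hne (fun h => Finset.disjoint_left.1 hSZ hu (h ▸ hgu))
    (fun h => Finset.disjoint_left.1 hSZ hv (h ▸ hgu)) (hS u hu) (hS v hv) (hZ _ hgu)
    (h1.trans h2.symm) h1

/-- Follow the walk until it first meets `x`, if it does. -/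
theorem Reachable.delete_or_exists {V : Type*} {H : SimpleGraph V} {y w : V}
    (h : H.Reachable y w) (x : V) (hy : y ≠ x) :
    (H.deleteIncidenceSet x).Reachable y w ∨
      ∃ u, H.Adj u x ∧ (H.deleteIncidenceSet x).Reachable y u := by
  obtain ⟨p⟩ := h
  induction p with
  | nil => exact .inl (Reachable.refl _)
  | @cons u v w huv p ih =>
    by_cases hv : v = x
    · exact .inr ⟨u, hv ▸ huv, Reachable.refl _⟩
    · have : (H.deleteIncidenceSet x).Reachable u v :=
        (deleteIncidenceSet_adj.2 ⟨huv, hy, hv⟩).reachable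
      rcases ih hv with h | ⟨z, hz, h⟩
      · exact .inl (this.trans h)
      · exact .inr ⟨z, hz, this.trans h⟩

/-- The graph of the edges of colour `α` or `β`. -/
def bicolored (φ : V → V → Option K) (α β : K) : SimpleGraph V :=
  fromRel fun u v => φ u v = some α ∨ φ u v = some β

theorem IsPartialEdgeColoring.bicolored_adj (h : IsPartialEdgeColoring G c φ) {α β : K} {u v : V} :
    (bicolored φ α β).Adj u v ↔ φ u v = some α ∨ φ u v = some β := by
  rw [bicolored, fromRel_adj, h.symm v u, or_self, and_iff_right_iff_imp]
  rintro (h' | h') <;> exact (h.adj _ _ _ h').ne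

variable [Fintype V] {x y : V} {α β : K}

theorem IsPartialEdgeColoring.card_color_le (h : IsPartialEdgeColoring G c φ) (v : V) (a : K) :
    #{w | φ v w = some a} ≤ 1 :=
  card_le_one.2 fun u hu w hw => h.inj v u w a (mem_filter.1 hu).2 (mem_filter.1 hw).2

theorem IsPartialEdgeColoring.card_bicolored_le (h : IsPartialEdgeColoring G c φ) (α β : K)
    (v : V) : #{w | (bicolored φ α β).Adj v w} ≤ 2 := by
  simp only [h.bicolored_adj, filter_or]
  exact (card_union_le _ _).trans (Nat.add_le_add (h.card_color_le v α) (h.card_color_le v β))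

theorem IsPartialEdgeColoring.card_bicolored_le_one_left (h : IsPartialEdgeColoring G c φ) {v : V}
    (hv : ∀ w, φ v w ≠ some α) (β : K) : #{w | (bicolored φ α β).Adj v w} ≤ 1 := by
  simp only [h.bicolored_adj, hv, false_or]
  exact h.card_color_le v β

theorem IsPartialEdgeColoring.card_bicolored_le_one_right (h : IsPartialEdgeColoring G c φ) {v : V}
    (hv : ∀ w, φ v w ≠ some β) (α : K) : #{w | (bicolored φ α β).Adj v w} ≤ 1 := by
  simp only [h.bicolored_adj, hv, or_false]
  exact h.card_color_le v α

theorem card_option_toFinset_le_one {α : Type*} (o : Option α) : #o.toFinset ≤ 1 := by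
  cases o <;> simp

theorem card_le_card_missing_add
    [Fintype K] (v : V) {N : Finset V}
    (hN : ∀ w a, φ v w = some a → w ∈ N) :
    Fintype.card K ≤ #{a | Missing c φ v a} + #N + #(c v).toFinset := by
  rw [← card_univ, ← card_filter_add_card_filter_not (s := univ) (fun a => Missing c φ v a),
    add_assoc]
  refine Nat.add_le_add_left ?_ _
  have hsub : ({a | ¬ Missing c φ v a} : Finset K) ⊆
      (N.biUnion fun w => (φ v w).toFinset) ∪ (c v).toFinset := by
    intro a ha
    simp only [mem_filter, mem_univ, true_and, Missing, not_and_or, not_forall, not_not] at ha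
    rw [mem_union]
    rcases ha with ⟨w, hw⟩ | ha
    · exact .inl (mem_biUnion.2 ⟨w, hN w a hw, by simp [hw]⟩)
    · exact .inr (by simp [ha])
  refine (card_le_card hsub).trans ((card_union_le _ _).trans (Nat.add_le_add_right ?_ _))
  refine card_biUnion_le.trans ?_
  rw [card_eq_sum_ones]
  exact sum_le_sum fun w _ => card_option_toFinset_le_one _

/-! ### How many fan vertices can miss the same colour -/

namespace IsMaxUncolored

theorem exists_swap (h : IsMaxUncolored G c φ x y) (hβ : ∀ v, c v ≠ some β)
    (hy : Missing c φ y α) (hc : ∀ w, (bicolored φ α β).Reachable y w → c w ≠ some α) :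
    ∃ ψ, IsMaxUncolored G c ψ x y ∧ Missing c ψ y β ∧
      ∀ v, ¬ (bicolored φ α β).Reachable y v → ∀ a, Missing c φ v a → Missing c ψ v a :=
  h.swap (C := {w | (bicolored φ α β).Reachable y w}) (Reachable.refl y)
    (fun _ hu _ hv => hu.trans (h.isPartial.bicolored_adj.2 hv).reachable)
    (fun u hu => ⟨hc u hu, hβ u⟩) hy

/-- Restatement of `exists_shift` for two colours, with the graph of these colours. -/
theorem exists_shift_bicolored (h : IsMaxUncolored G c φ x y) {b : V}
    (hb : ReflTransGen (FanRel c φ x) y b) (hα : Missing c φ b α)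
    (hβ : ∀ p, ReflTransGen (FanRel c φ x) y p → ¬ (∃ w, φ x w = some β) ∨ ¬ Missing c φ p β) :
    ∃ ψ, IsMaxUncolored G c ψ x b ∧ Missing c ψ b α ∧
      (∀ a, Missing c ψ x a ↔ Missing c φ x a) ∧
      (bicolored ψ α β).deleteIncidenceSet x = (bicolored φ α β).deleteIncidenceSet x ∧
      (∀ v, ψ x v = some β ↔ φ x v = some β) ∧
      (bicolored ψ α β = bicolored φ α β ∨ ∃ p ψ', ReflTransGen (FanRel c φ x) y p ∧
        IsMaxUncolored G c ψ' x p ∧ Missing c ψ' p α ∧ Missing c φ p α ∧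
        (∀ a, Missing c ψ' x a ↔ Missing c φ x a) ∧
        bicolored ψ' α β = bicolored φ α β ∧ ∀ u, ψ x u = some α → u = p) := by
  -- A fan step along an edge of colour `β` would need both such an edge at `x` and a fan vertex
  -- missing `β`, which `hβ` excludes.
  have hβfree : ∀ {T b}, SimpleWalk (FanRel c φ x) y T b → ∀ v ∈ T, φ x v ≠ some β := by
    intro T b hT
    induction hT with
    | single =>
      rintro v rfl hv
      simp [h.uncolored] at hv
    | @snoc T p d hT hr hd ih =>
      rintro v (rfl | hv) hvβ
      · obtain ⟨γ, hpγ, hγ⟩ := hr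
        obtain rfl : β = γ := Option.some_injective _ (hvβ ▸ hγ)
        rcases hβ p hT.reflTransGen with h' | h'
        · exact h' ⟨_, hvβ⟩
        · exact h' hpγ
      · exact ih v hv hvβ
  have hgraph : ∀ {ψ : V → V → Option K} {b : V}, IsMaxUncolored G c ψ x b →
      (∀ u v, u ≠ x → v ≠ x → ψ u v = φ u v) → (∀ v, ψ x v = some β ↔ φ x v = some β) →
      (∀ v, ψ x v = some α ↔ φ x v = some α) → bicolored ψ α β = bicolored φ α β := by
    intro ψ b hψ h1 h2 h3
    ext u v
    rw [hψ.isPartial.bicolored_adj, h.isPartial.bicolored_adj]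
    by_cases hu : u = x
    · rw [hu, h2, h3]
    · by_cases hv : v = x
      · rw [hv, hψ.isPartial.symm, h.isPartial.symm, h2, h3]
      · rw [h1 u v hu hv]
  obtain ⟨T, hT⟩ := SimpleWalk.of_reflTransGen hb
  obtain ⟨ψ, h1, h2, h3, h4, h5, h6, h7⟩ := h.exists_shift hT
  have hβψ := h6 β (hβfree hT)
  refine ⟨ψ, h1, h5 α hα, h4, ?_, hβψ, ?_⟩
  · ext u v
    rw [deleteIncidenceSet_adj, deleteIncidenceSet_adj, h1.isPartial.bicolored_adj,
      h.isPartial.bicolored_adj]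
    refine and_congr_left fun huv => ?_
    rw [h2 u v huv.1 huv.2]
  -- Only the `α`-edge at `x` can alter the bicoloured graph. If the shift moves it, its new end is
  -- `p`, and a shift stopping at `p` leaves the graph unchanged.
  · by_cases hαT : ∃ v ∈ T, φ x v = some α
    · obtain ⟨p, T', hT', hfree, hpα, hp⟩ := h7 α hαT
      obtain ⟨ψ', g1, g2, -, g4, g5, g6, -⟩ := h.exists_shift hT'
      exact .inr ⟨p, ψ', hT'.reflTransGen, g1, g5 α hpα, hpα, g4,
        hgraph g1 g2 (g6 β (hβfree hT')) (g6 α hfree),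
        fun u hu => h1.isPartial.inj _ _ _ _ hu hp⟩
    · push Not at hαT
      exact .inl (hgraph h1 h2 hβψ (h6 α hαT))

theorem fan_adj (h : IsMaxUncolored G c φ x y) {b : V}
    (hb : ReflTransGen (FanRel c φ x) y b) : G.Adj x b := by
  rcases ReflTransGen.cases_tail hb with rfl | ⟨_, _, γ, _, hγ⟩
  · exact h.adj
  · exact h.isPartial.adj _ _ _ hγ

/-- If the unused colour `β` is missing at the centre `x` of the fan, then from every fan vertex
missing `α`, the path of colours `α`, `β` ends in a vertex of colour `α` or in `x`. -/
theorem exists_reachable_of_missing_center (h : IsMaxUncolored G c φ x y)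
    (hβ : ∀ v, c v ≠ some β) (hx : Missing c φ x β) {b : V}
    (hb : ReflTransGen (FanRel c φ x) y b) (hα : Missing c φ b α) :
    ∃ w, (c w = some α ∨ w = x) ∧ (bicolored φ α β).Reachable b w := by
  -- Otherwise exchanging the colours on the chain of `b` makes `β` missing at both ends of the
  -- uncoloured edge `xb`.
  have base : ∀ {ψ : V → V → Option K} {b : V}, IsMaxUncolored G c ψ x b → Missing c ψ x β →
      Missing c ψ b α → ∃ w, (c w = some α ∨ w = x) ∧ (bicolored ψ α β).Reachable b w := by
    intro ψ b h1 h2 h3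
    by_contra hcon
    push Not at hcon
    obtain ⟨χ, hχ, hb, hm⟩ := h1.exists_swap hβ h3 fun w hw hwα => hcon w (.inl hwα) hw
    exact hχ.not_missing_both (hm x (hcon x (.inr rfl)) β h2) hb
  have hbx : b ≠ x := (h.fan_adj hb).ne'
  obtain ⟨ψ, h1, h2, h3, h4, h5, h6⟩ := h.exists_shift_bicolored (β := β) hb hα fun p _ =>
    .inl fun ⟨w, hw⟩ => hx.1 w hw
  obtain ⟨w, hw, hr⟩ := base h1 ((h3 β).2 hx) h2
  rcases h6 with h6 | ⟨p, ψ', -, g1, g2, -, g4, g5, g6⟩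
  · exact ⟨w, hw, h6 ▸ hr⟩
  -- Away from `x` the two graphs agree. A chain reaching `x` does so through the shifted `α`-edge,
  -- hence from `p`, and the chain of `p` can be followed in the unchanged graph.
  · rcases hr.delete_or_exists x hbx with hr | ⟨u, hu, hr⟩
    · rw [h4] at hr
      exact ⟨w, hw, hr.mono (deleteIncidenceSet_le _ _)⟩
    · rw [h4] at hr
      rw [h1.isPartial.bicolored_adj, h1.isPartial.symm] at hu
      rcases hu with hu | hu
      · obtain rfl := g6 u hu
        obtain ⟨w', hw', hr'⟩ := base g1 ((g4 β).2 hx) g2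
        exact ⟨w', hw', (hr.mono (deleteIncidenceSet_le _ _)).trans (g5 ▸ hr')⟩
      · exact absurd ((h5 u).1 hu) (hx.1 u)

/-- If no end of an uncoloured edge ever misses the unused colour `β`, then from every fan vertex
missing `α`, the path of colours `α`, `β` ends in a vertex of colour `α` or reaches the edge of
colour `β` at the centre `x` of the fan from its other end. -/
theorem exists_reachable_of_not_missing (h : IsMaxUncolored G c φ x y)
    (hβ : ∀ v, c v ≠ some β)
    (hno : ∀ ψ b, IsMaxUncolored G c ψ x b → ¬ Missing c ψ b β) {b : V}
    (hb : ReflTransGen (FanRel c φ x) y b) (hα : Missing c φ b α) :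
    (∃ w, c w = some α ∧ (bicolored φ α β).Reachable b w) ∨
      ∃ z, φ x z = some β ∧ ((bicolored φ α β).deleteIncidenceSet x).Reachable b z := by
  -- Otherwise the exchange makes `β` missing at `b`, against `hno`.
  have base : ∀ {ψ : V → V → Option K} {b : V}, IsMaxUncolored G c ψ x b →
      Missing c ψ b α → ∃ w, c w = some α ∧ (bicolored ψ α β).Reachable b w := by
    intro ψ b h1 h3
    by_contra hcon
    push Not at hcon
    obtain ⟨χ, hχ, hb, -⟩ := h1.exists_swap hβ h3 fun w hw hwα => hcon w hwα hw
    exact hno χ b hχ hb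
  have hbx : b ≠ x := (h.fan_adj hb).ne'
  have hfan : ∀ p, ReflTransGen (FanRel c φ x) y p → ¬ Missing c φ p β := by
    intro p hp hpβ
    obtain ⟨T, hT⟩ := SimpleWalk.of_reflTransGen hp
    obtain ⟨ψ, h1, -, -, -, h5, -⟩ := h.exists_shift hT
    exact hno ψ p h1 (h5 β hpβ)
  obtain ⟨ψ, h1, h2, h3, h4, h5, h6⟩ := h.exists_shift_bicolored (β := β) hb hα fun p hp =>
    .inr (hfan p hp)
  obtain ⟨w, hw, hr⟩ := base h1 h2
  rcases h6 with h6 | ⟨p, ψ', -, g1, g2, -, g4, g5, g6⟩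
  · exact .inl ⟨w, hw, h6 ▸ hr⟩
  · rcases hr.delete_or_exists x hbx with hr | ⟨u, hu, hr⟩
    · rw [h4] at hr
      exact .inl ⟨w, hw, hr.mono (deleteIncidenceSet_le _ _)⟩
    · rw [h4] at hr
      rw [h1.isPartial.bicolored_adj, h1.isPartial.symm] at hu
      rcases hu with hu | hu
      · obtain rfl := g6 u hu
        obtain ⟨w', hw', hr'⟩ := base g1 g2
        exact .inl ⟨w', hw', (hr.mono (deleteIncidenceSet_le _ _)).trans (g5 ▸ hr')⟩
      · exact .inr ⟨u, (h5 u).1 hu, hr⟩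

/-- Vertices coloured `α` have no `α`-edge and `x` has no `β`-edge, so all of them are chain ends;
each chain ending at one of them has only one other end. -/
theorem card_fan_missing_le_of_missing_center (h : IsMaxUncolored G c φ x y) {r : ℕ}
    (hV : ∀ a, #{v | c v = some a} ≤ r) (hβ : ∀ v, c v ≠ some β) (hx : Missing c φ x β) (α : K) :
    #{b | ReflTransGen (FanRel c φ x) y b ∧ Missing c φ b α} ≤ r + 1 := by
  have hP := h.isPartial
  refine le_trans (card_le_of_reachable_ends (H := bicolored φ α β)
    (Z := insert x ({v | c v = some α} : Finset V)) (hP.card_bicolored_le α β) ?_ ?_ ?_ ?_)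
    ((card_insert_le _ _).trans (Nat.add_le_add_right (hV α) 1))
  · intro v hv
    exact hP.card_bicolored_le_one_left (mem_filter.1 hv).2.2.1 β
  · intro v hv
    rcases mem_insert.1 hv with rfl | hv
    · exact hP.card_bicolored_le_one_right hx.1 α
    · exact hP.card_bicolored_le_one_left
        (fun w hw => hP.avoid _ _ _ hw (mem_filter.1 hv).2) β
  · rw [Finset.disjoint_left]
    intro v hv hv'
    obtain ⟨-, h1, h2⟩ := mem_filter.1 hv
    rcases mem_insert.1 hv' with rfl | hv'
    · exact (h.fan_adj h1).ne rfl
    · exact h2.2 (mem_filter.1 hv').2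
  · intro v hv
    obtain ⟨-, h1, h2⟩ := mem_filter.1 hv
    obtain ⟨w, hw, hr⟩ := h.exists_reachable_of_missing_center hβ hx h1 h2
    refine ⟨w, ?_, hr⟩
    rcases hw with hw | rfl
    · exact mem_insert_of_mem (by simp [hw])
    · exact mem_insert_self _ _

/-- Chains reaching a vertex coloured `α` account for at most `r` fan vertices. The others reach,
without passing `x`, the far end `z` of the `β`-edge at `x`; once `x` is deleted `z` is a chain end
too, so there is at most one of these. -/
theorem card_fan_missing_le_of_not_missing (h : IsMaxUncolored G c φ x y) {r : ℕ}
    (hV : ∀ a, #{v | c v = some a} ≤ r) (hβ : ∀ v, c v ≠ some β)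
    (hno : ∀ ψ b, IsMaxUncolored G c ψ x b → ¬ Missing c ψ b β) (α : K) :
    #{b | ReflTransGen (FanRel c φ x) y b ∧ Missing c φ b α} ≤ r + 1 := by
  have hP := h.isPartial
  set S : Finset V := {b | ReflTransGen (FanRel c φ x) y b ∧ Missing c φ b α} with hS
  have hS1 : ∀ v ∈ S, #{w | (bicolored φ α β).Adj v w} ≤ 1 := fun v hv =>
    hP.card_bicolored_le_one_left (mem_filter.1 hv).2.2.1 β
  obtain ⟨J, hJ⟩ : ∃ J, J = (bicolored φ α β).deleteIncidenceSet x := ⟨_, rfl⟩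
  have hJadj : ∀ {u v}, J.Adj u v ↔ (bicolored φ α β).Adj u v ∧ u ≠ x ∧ v ≠ x := by
    rw [hJ]; exact deleteIncidenceSet_adj
  have hJle : ∀ v, #{w | J.Adj v w} ≤ #{w | (bicolored φ α β).Adj v w} := fun v =>
    card_le_card (monotone_filter_right _ fun w _ hw => (hJadj.1 hw).1)
  rw [← card_filter_add_card_filter_not (s := S)
    (fun b => ∃ w, c w = some α ∧ (bicolored φ α β).Reachable b w)]
  refine Nat.add_le_add (le_trans (card_le_of_reachable_ends (H := bicolored φ α β)
    (Z := ({v | c v = some α} : Finset V)) (hP.card_bicolored_le α β) ?_ ?_ ?_ ?_) (hV α)) ?_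
  · exact fun v hv => hS1 v (mem_filter.1 hv).1
  · intro v hv
    exact hP.card_bicolored_le_one_left
      (fun w hw => hP.avoid _ _ _ hw (mem_filter.1 hv).2) β
  · rw [Finset.disjoint_left]
    intro v hv hv'
    exact (mem_filter.1 (mem_filter.1 hv).1).2.2.2 (mem_filter.1 hv').2
  · intro v hv
    obtain ⟨w, hw, hr⟩ := (mem_filter.1 hv).2
    exact ⟨w, by simp [hw], hr⟩
  · refine card_le_one.2 fun u hu v hv => ?_
    have key : ∀ u ∈ ({b ∈ S | ¬ ∃ w, c w = some α ∧ (bicolored φ α β).Reachable b w} : Finset V),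
        ∃ z, φ x z = some β ∧ J.Reachable u z := by
      intro u hu
      obtain ⟨huS, hu⟩ := mem_filter.1 hu
      obtain ⟨-, h1, h2⟩ := mem_filter.1 huS
      rw [hJ]
      exact (h.exists_reachable_of_not_missing hβ hno h1 h2).resolve_left hu
    obtain ⟨z, hz, hruz⟩ := key u hu
    obtain ⟨z', hz', hrvz⟩ := key v hv
    obtain rfl := hP.inj _ _ _ _ hz' hz
    by_contra hne
    have huS := (mem_filter.1 hu).1
    have hvS := (mem_filter.1 hv).1
    have hzJ : ∀ w, J.Adj z' w → φ z' w = some α := by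
      intro w hw
      obtain ⟨hw, -, hwx⟩ := hJadj.1 hw
      refine (hP.bicolored_adj.1 hw).resolve_right fun hw => ?_
      rw [hP.symm] at hz
      exact hwx (hP.inj _ _ _ _ hw hz)
    -- A vertex of `S` equal to `z'` lacks an `α`-edge and has lost its `β`-edge to `x`, so it is
    -- isolated in `J`.
    have hisol : ∀ u ∈ S, ∀ v, J.Reachable v u → u = z' → v = u := by
      intro u hu v hr huz
      obtain ⟨p⟩ := hr.symm
      cases p with
      | nil => rfl
      | cons hadj _ =>
        exact absurd (hzJ _ (huz ▸ hadj)) (huz ▸ (mem_filter.1 hu).2.2.1 _)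
    have hzJ1 : #{w | J.Adj z' w} ≤ 1 :=
      (card_le_card (monotone_filter_right _ fun w _ hw => hzJ w hw)).trans (hP.card_color_le z' α)
    refine not_reachable_three_ends (H := J) (a := u) (b := v) (d := z')
      (fun v => (hJle v).trans (hP.card_bicolored_le α β v)) hne ?_ ?_
      ((hJle _).trans (hS1 _ huS)) ((hJle _).trans (hS1 _ hvS)) hzJ1
      (hruz.trans hrvz.symm) hruz
    · intro huz
      exact hne (hisol u huS v (huz ▸ hrvz) huz).symm
    · intro hvz
      exact hne (hisol v hvS u (hvz ▸ hruz) hvz)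

/-- Pairs (fan vertex, colour missing there) are counted twice: at least (r+1)·#F + 1 by vertices,
the extra one from the uncoloured edge at `y`, and at most (r+1)·#U by colours. -/
theorem false_of_card_fan_missing_le [Fintype K] (h : IsMaxUncolored G c φ x y) {r : ℕ}
    (hdeg : ∀ v, #{w | G.Adj v w} + #(c v).toFinset + (r + 1) ≤ Fintype.card K)
    (hle : ∀ a, #{b | ReflTransGen (FanRel c φ x) y b ∧ Missing c φ b a} ≤ r + 1) : False := by
  have hP := h.isPartial
  set F : Finset V := {b | ReflTransGen (FanRel c φ x) y b} with hF
  have hyF : y ∈ F := by simp [hF, ReflTransGen.refl]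
  set U : Finset K := {a | ∃ b ∈ F, Missing c φ b a} with hU
  -- A colour of `U` appears on an edge from `x` to the fan, other than the uncoloured `xy`, or is
  -- the colour of `x`: the loss of one and the gain of one cancel.
  have hUle : #U ≤ #F := by
    have hsub : U ⊆ ((F.erase y).biUnion fun w => (φ x w).toFinset) ∪ (c x).toFinset := by
      intro a ha
      obtain ⟨-, b, hb, hba⟩ := mem_filter.1 ha
      have hbF := (mem_filter.1 hb).2
      obtain ⟨T, hT⟩ := SimpleWalk.of_reflTransGen hbF
      obtain ⟨ψ, h1, -, -, h4, h5, -⟩ := h.exists_shift hT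
      have hx : ¬ Missing c φ x a := fun hx => h1.not_missing_both ((h4 a).2 hx) (h5 a hba)
      simp only [Missing, not_and_or, not_forall, ne_eq, not_not] at hx
      rw [mem_union]
      rcases hx with ⟨w, hw⟩ | hx
      · refine .inl (mem_biUnion.2 ⟨w, mem_erase.2 ⟨?_, ?_⟩, by simp [hw]⟩)
        · rintro rfl
          simp [h.uncolored] at hw
        · exact mem_filter.2 ⟨mem_univ _, hbF.tail ⟨a, hba, hw⟩⟩
      · exact .inr (by simp [hx])
    refine (card_le_card hsub).trans ((card_union_le _ _).trans ?_)
    have h1 : #((F.erase y).biUnion fun w => (φ x w).toFinset) ≤ #(F.erase y) := by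
      refine card_biUnion_le.trans ?_
      rw [card_eq_sum_ones]
      exact sum_le_sum fun w _ => card_option_toFinset_le_one _
    have h2 : #(c x).toFinset ≤ 1 := card_option_toFinset_le_one _
    rw [card_erase_of_mem hyF] at h1
    have : 0 < #F := card_pos.2 ⟨y, hyF⟩
    omega
  have hsum : ∑ b ∈ F, #{a ∈ U | Missing c φ b a} = ∑ a ∈ U, #{b ∈ F | Missing c φ b a} :=
    sum_card_bipartiteAbove_eq_sum_card_bipartiteBelow (Missing c φ)
  have hup : ∑ a ∈ U, #{b ∈ F | Missing c φ b a} ≤ #U * (r + 1) :=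
    sum_le_card_nsmul _ _ _ fun a _ => by
      rw [hF, filter_filter]
      exact hle a
  have hmU : ∀ b ∈ F, #{a ∈ U | Missing c φ b a} = #{a | Missing c φ b a} := by
    intro b hb
    congr 1
    ext a
    simp only [hU, mem_filter, mem_univ, true_and, and_iff_right_iff_imp]
    exact fun ha => ⟨b, hb, ha⟩
  have hlow : ∀ b ∈ F, r + 1 + (if b = y then 1 else 0) ≤ #{a ∈ U | Missing c φ b a} := by
    intro b hb
    rw [hmU b hb]
    have h1 := hdeg b
    split_ifs with hby
    · subst hby
      have h2 := card_le_card_missing_add (c := c) b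
        (N := ({w | G.Adj b w} : Finset V).erase x) fun w a hw => by
          refine mem_erase.2 ⟨?_, by simpa using hP.adj _ _ _ hw⟩
          rintro rfl
          rw [hP.symm, h.uncolored] at hw
          simp at hw
      have h3 : x ∈ ({w | G.Adj b w} : Finset V) := by simpa using h.adj.symm
      have h4 : 0 < #{w | G.Adj b w} := card_pos.2 ⟨x, h3⟩
      rw [card_erase_of_mem h3] at h2
      omega
    · have h2 := card_le_card_missing_add (c := c) b
        (N := ({w | G.Adj b w} : Finset V)) fun w a hw => by simpa using hP.adj _ _ _ hw
      omega
  have hlow' := sum_le_sum hlow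
  rw [sum_add_distrib, sum_const, sum_ite_eq' F y, if_pos hyF, hsum, smul_eq_mul] at hlow'
  have := Nat.mul_le_mul_right (r + 1) hUle
  omega

end IsMaxUncolored

/-- A vertex colouring `c` with at most `r` vertices of each colour, not using all colours, extends
to the edges if there are enough colours. -/
theorem exists_edge_coloring [Fintype K] (G : SimpleGraph V) (c : V → Option K) {r : ℕ}
    (hV : ∀ a, #{v | c v = some a} ≤ r) (hβ : ∀ v, c v ≠ some β)
    (hdeg : ∀ v, #{w | G.Adj v w} + #(c v).toFinset + (r + 1) ≤ Fintype.card K) :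
    ∃ φ, IsPartialEdgeColoring G c φ ∧ ∀ u v, G.Adj u v → φ u v ≠ none := by
  have hempty : IsPartialEdgeColoring G c (fun _ _ => none) :=
    ⟨fun _ _ => rfl, by simp, by simp, by simp⟩
  obtain ⟨φ, hφ, hmax⟩ := exists_max_image
    (univ.filter fun φ : V → V → Option K => IsPartialEdgeColoring G c φ) coloredCount
    ⟨_, mem_filter.2 ⟨mem_univ _, hempty⟩⟩
  refine ⟨φ, (mem_filter.1 hφ).2, fun x y hxy hn => ?_⟩
  have h : IsMaxUncolored G c φ x y := ⟨(mem_filter.1 hφ).2, fun ψ hψ =>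
    hmax ψ (mem_filter.2 ⟨mem_univ _, hψ⟩), hxy, hn⟩
  -- First `β` is shown never to be missing at the centre. Reversing the uncoloured edge, it is
  -- never missing at the other end either, which is what the second count needs.
  have hcenter : ∀ {ψ : V → V → Option K} {x y : V}, IsMaxUncolored G c ψ x y →
      ¬ Missing c ψ x β := fun h hx =>
    h.false_of_card_fan_missing_le hdeg (h.card_fan_missing_le_of_missing_center hV hβ hx)
  exact h.false_of_card_fan_missing_le hdeg
    (h.card_fan_missing_le_of_not_missing hV hβ fun ψ b hψ => hcenter hψ.symm)

end ConstrainedEdgeColoring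

/-! ### Total colourings -/

section TotalColoring

open Classical Finset

theorem totalColorable_of_edge_coloring {V : Type*} {G : SimpleGraph V} {k : ℕ} {c : V → Fin k}
    {φ : V → V → Option (Fin k)} (hc : ∀ u v, G.Adj u v → c u ≠ c v)
    (hφ : IsPartialEdgeColoring G (fun v => some (c v)) φ)
    (hfull : ∀ u v, G.Adj u v → φ u v ≠ none) : G.TotalColorable k := by
  have hex : ∀ e : G.edgeSet, ∃ a, ∀ u v, (e : Sym2 V) = s(u, v) → φ u v = some a := by
    rintro ⟨e, he⟩
    induction e with | _ u v
    obtain ⟨a, ha⟩ := Option.ne_none_iff_exists'.1 (hfull u v he)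
    refine ⟨a, fun u' v' h => ?_⟩
    rcases Sym2.eq_iff.1 h with ⟨rfl, rfl⟩ | ⟨rfl, rfl⟩
    · exact ha
    · rw [hφ.symm, ha]
  choose col hcol using hex
  refine ⟨Sum.elim c col, hc, ?_, ?_⟩
  · rintro e f hef ⟨v, ⟨u, hu⟩, ⟨w, hw⟩⟩ h
    have h1 := hcol e v u hu
    have h2 := hcol f v w hw
    have h3 : col e = col f := h
    rw [← h3] at h2
    have := hφ.inj _ _ _ _ h1 h2
    exact hef (Subtype.ext (by rw [hu, hw, this]))
  · rintro v e ⟨u, hu⟩ h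
    have h3 : c v = col e := h
    exact hφ.avoid v u _ (hcol e v u hu) (congrArg some h3)

theorem TotalColorable.mono {V : Type*} {G : SimpleGraph V} {k l : ℕ} (h : G.TotalColorable k)
    (hkl : k ≤ l) : G.TotalColorable l := by
  obtain ⟨c, h1, h2, h3⟩ := h
  have hi := Fin.castLE_injective hkl
  exact ⟨fun x => Fin.castLE hkl (c x), fun u v huv h => h1 u v huv (hi h),
    fun e f hef hv h => h2 e f hef hv (hi h), fun v e hv h => h3 v e hv (hi h)⟩

variable {V : Type*} [Fintype V]

/-- If `G` has at most `d + 1` vertices and maximum degree at most `d`, then it has a total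
colouring with `d + 2` colours and distinct vertex colours. -/
theorem totalColorable_of_card_le_succ (G : SimpleGraph V) {d : ℕ}
    (hdeg : ∀ v, #{w | G.Adj v w} ≤ d) (hcard : Fintype.card V ≤ d + 1) :
    G.TotalColorable (d + 2) := by
  obtain ⟨H, hss, hns⟩ : ∃ H : SimpleGraph (Option V),
      (∀ u v, H.Adj (some u) (some v) ↔ G.Adj u v) ∧ ∀ v, H.Adj none (some v) := by
    refine ⟨SimpleGraph.fromRel fun u v => u = none ∨ ∃ a b, u = some a ∧ v = some b ∧ G.Adj a b,
      fun u v => ?_, fun v => ?_⟩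
    · simp only [fromRel_adj, ne_eq, Option.some.injEq, reduceCtorEq, false_or]
      constructor
      · rintro ⟨-, ⟨a, b, rfl, rfl, h⟩ | ⟨a, b, rfl, rfl, h⟩⟩
        · exact h
        · exact h.symm
      · exact fun h => ⟨h.ne, .inl ⟨u, v, rfl, rfl, h⟩⟩
    · simp
  -- With no vertex coloured and r = 0 this is Vizing's theorem for the join `H`, whose degrees are
  -- at most d+1: the new vertex has at most d+1 neighbours, and each old degree grows by one.
  obtain ⟨φ, hφ, hfull⟩ := exists_edge_coloring (K := Fin (d + 2)) (β := 0) (r := 0) H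
    (fun _ => none) (by simp) (by simp) (by
      rintro (_ | v)
      · have : ({w | H.Adj none w} : Finset (Option V)) ⊆ univ.map Function.Embedding.some := by
          rintro (_ | w) hw
          · simp at hw
          · simp
        have := card_le_card this
        rw [card_map, card_univ] at this
        simp only [Option.toFinset_none, card_empty, Fintype.card_fin]
        omega
      · have : ({w | H.Adj (some v) w} : Finset (Option V)) ⊆
            insert none (({w | G.Adj v w} : Finset V).map Function.Embedding.some) := by
          rintro (_ | w) hw
          · simp
          · have := (hss v w).1 (mem_filter.1 hw).2
            simp [this]
        have := (card_le_card this).trans (card_insert_le _ _)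
        rw [card_map] at this
        have := hdeg v
        simp only [Option.toFinset_none, card_empty, Fintype.card_fin]
        omega)
  have hex : ∀ v, ∃ a, φ none (some v) = some a := fun v =>
    Option.ne_none_iff_exists'.1 (hfull none (some v) (hns v))
  choose c hc using hex
  refine totalColorable_of_edge_coloring (c := c) (φ := fun u v => φ (some u) (some v)) ?_
    ⟨fun u v => hφ.symm _ _, fun u v a h => (hss u v).1 (hφ.adj _ _ _ h), fun u v w a hu hv =>
      Option.some_injective _ (hφ.inj _ _ _ _ hu hv), fun u v a hu h => ?_⟩
    fun u v huv => hfull _ _ ((hss u v).2 huv)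
  · intro u v huv h
    have h1 := hc u
    rw [h] at h1
    exact huv.ne (Option.some_injective _ (hφ.inj _ _ _ _ h1 (hc v)))
  · have h1 := hc u
    rw [h, hφ.symm] at h1
    exact absurd (hφ.inj _ _ _ _ hu h1) (by simp)

theorem totalColorable_of_card_le_mul (G : SimpleGraph V) {d r : ℕ}
    (hdeg : ∀ v, #{w | G.Adj v w} ≤ d) (hcard : Fintype.card V ≤ r * (d + 1)) :
    G.TotalColorable (d + 2 * r) := by
  rcases Nat.lt_or_ge r 2 with hr | hr
  · interval_cases r
    · have : IsEmpty V := Fintype.card_eq_zero_iff.1 (by omega)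
      have : IsEmpty G.edgeSet := ⟨fun ⟨e, _⟩ => by induction e with | _ u v => exact isEmptyElim u⟩
      exact ⟨isEmptyElim, fun u => isEmptyElim u, fun e => isEmptyElim e, fun u => isEmptyElim u⟩
    · exact totalColorable_of_card_le_succ G hdeg (by omega)
  · obtain ⟨f, hf, hfr⟩ := G.exists_coloring_card_le (k := d + 1) (r := r)
      (fun v => Nat.lt_succ_of_le (hdeg v)) hcard
    have hle : d + 1 ≤ d + 2 * r := by omega
    have hi := Fin.castLE_injective hle
    -- The vertices use the colours 0, …, d, so d+1 is free to serve as `β`. The degree condition d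
    -- + 1 + (r+1) ≤ d + 2r is exactly r ≥ 2.
    obtain ⟨φ, hφ, hfull⟩ := exists_edge_coloring (K := Fin (d + 2 * r))
      (β := ⟨d + 1, by omega⟩) (r := r) G (fun v => some (Fin.castLE hle (f v))) (by
        intro a
        by_cases ha : ∃ b, Fin.castLE hle b = a
        · obtain ⟨b, rfl⟩ := ha
          simpa [hi.eq_iff] using hfr b
        · push Not at ha
          simp [ha]) (by
        intro v h
        have := congrArg Fin.val (Option.some_injective _ h)
        simp only [Fin.val_castLE] at this
        omega) (by
        intro v
        have := hdeg v
        simp only [Option.toFinset_some, card_singleton, Fintype.card_fin]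
        omega)
    exact totalColorable_of_edge_coloring (fun u v huv h => hf u v huv (hi h)) hφ hfull

end TotalColoring

end SimpleGraph

theorem theorem1 {V : Type*} [Fintype V] (G : SimpleGraph V) [DecidableRel G.Adj] :
    G.totalChromaticNumber ≤
        ((G.maxDegree + 2 * ⌈(Fintype.card V : ℚ) / ((G.maxDegree : ℚ) + 1)⌉₊ : ℕ) : ℕ∞) ∧
      (0 < G.maxDegree →
        G.maxDegree + 2 * ⌈(Fintype.card V : ℚ) / ((G.maxDegree : ℚ) + 1)⌉₊ + 1 ≤
          G.maxDegree + 2 * ⌈(Fintype.card V : ℚ) / (G.maxDegree : ℚ)⌉₊ + 1) ∧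
      ((Fintype.card V : ℚ) / 2 ≤ (G.maxDegree : ℚ) → G.TotalColorable (G.maxDegree + 4)) := by
  have hpos : (0 : ℚ) < (G.maxDegree : ℚ) + 1 := by positivity
  have hcol : G.TotalColorable
      (G.maxDegree + 2 * ⌈(Fintype.card V : ℚ) / ((G.maxDegree : ℚ) + 1)⌉₊) := by
    refine G.totalColorable_of_card_le_mul (fun v => ?_) ?_
    · have := G.degree_le_maxDegree v
      rw [← SimpleGraph.card_neighborFinset_eq_degree, SimpleGraph.neighborFinset_eq_filter] at this
      convert this
    · have := (div_le_iff₀ hpos).1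
        (Nat.le_ceil ((Fintype.card V : ℚ) / ((G.maxDegree : ℚ) + 1)))
      exact_mod_cast this
  refine ⟨iInf₂_le _ hcol, fun h => ?_, fun h => hcol.mono ?_⟩
  · have h0 : (0 : ℚ) < G.maxDegree := by exact_mod_cast h
    have : ⌈(Fintype.card V : ℚ) / ((G.maxDegree : ℚ) + 1)⌉₊ ≤
        ⌈(Fintype.card V : ℚ) / (G.maxDegree : ℚ)⌉₊ := by
      refine Nat.ceil_mono ?_
      gcongr
      linarith
    omega
  · have : ⌈(Fintype.card V : ℚ) / ((G.maxDegree : ℚ) + 1)⌉₊ ≤ 2 := by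
      rw [Nat.ceil_le, div_le_iff₀ hpos]
      push_cast
      linarith
    omega
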